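/- Let $\mathbb F\in\{\mathbb R,\mathbb C\}$. Let $G$ be an étale groupoid (not necessarily Hausdorff) with locally compact Hausdorff unit space $X$, with domain and range maps $d,r$, and let $\mathcal L=\bigsqcup_{\gamma\in G}L_\gamma$ be a twist over $G$, i.e. a Fell line bundle over $\mathbb F$. Let $\mathfrak C_c(G,\mathcal L)$ be the linear span of the continuous compactly supported sections of $\mathcal L|_U$, extended by zero, over open bisections $U\subseteq G$, with the convolution product $(f*g)(\gamma)=\sum_{r(\eta)=r(\gamma)}f(\eta)\cdot g(\eta^{-1}\gamma)$. Put $$\|f\|_{d_*}=\sup_{x\in X}\sum_{d(\gamma)=x}|f(\gamma)|,\qquad \|f\|_{r_*}=\sup_{x\in X}\sum_{r(\gamma)=x}|f(\gamma)|,\qquad \|f\|_I=\max\{\|f\|_{d_*},\|f\|_{r_*}\},$$ and let $F(G,\mathcal L)$ be the Banach algebra completion of $\mathfrak C_c(G,\mathcal L)$ in the norm $\|f\|_{\max}=\inf\{\sum_{k=1}^n\|f_k\|_\infty\}$, the infimum being over all decompositions $f=\sum_{k=1}^n f_k$ into continuous compactly supported sections $f_k$ over open bisections $U_k$. Let $p,q\in[1,\infty]$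 with $1/p+1/q=1$ (where $1/\infty=0$), and let $\ell^p(G,\mathcal L)$ be the Banach space of all $p$-summable (bounded, if $p=\infty$) sections of $\mathcal L$, with its usual norm. Then the formula $\Lambda_p(f)\xi=f*\xi$, for $f\in\mathfrak C_c(G,\mathcal L)$ and $\xi\in\ell^p(G,\mathcal L)$, defines a unique contractive algebra homomorphism $\Lambda_p:F(G,\mathcal L)\to B(\ell^p(G,\mathcal L))$. It is injective on $\mathfrak C_c(G,\mathcal L)$, and: 1. for all $f\in\mathfrak C_c(G,\mathcal L)$ we have $\|\Lambda_p(f)\|\le\|f\|_{d_*}^{1/p}\,\|f\|_{r_*}^{1/q}\le\|f\|_I$ (with $t^0=1$ for all $t\ge 0$), while $\|\Lambda_1(f)\|=\|f\|_{d_*}$ and $\|\Lambda_\infty(f)\|=\|f\|_{r_*}$; 2. put $F^p_{\mathrm{red}}(G,\mathcal L)=\overline{\Lambda_p(\mathfrak C_c(G,\mathcal L))}$, and let $\mathcal L^{\mathrm{op}}$ be the opposite twist, with fibers $L^{\mathrm{op}}_\gamma=L_{\gamma^{-1}}$, multiplication $(z,w)\mapsto w\cdot z$, the involution of $\mathcal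 L$, and the topology that makes $\mathcal L^{\mathrm{op}}$ the pullback of $\mathcal L$ along $\gamma\mapsto\gamma^{-1}$. Then the map $f\mapsto\check f$, $\check f(\gamma)=f(\gamma^{-1})$, induces an isometric algebra isomorphism $F^p_{\mathrm{red}}(G,\mathcal L)^{\mathrm{op}}\cong F^q_{\mathrm{red}}(G,\mathcal L^{\mathrm{op}})$. In particular, for the trivial twist it induces an isometric isomorphism $F^p_{\mathrm{red}}(G)^{\mathrm{op}}\cong F^q_{\mathrm{red}}(G)$. -/

import Mathlib

open CategoryTheory Bundle Topology
open scoped ENNReal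

universe u v w

/-! ## Étale groupoids -/

namespace Arr

variable {X : Type u} [Groupoid.{v} X]

/-- The product `αβ` of two arrows that are composable in the sense that the domain of `α`
(its `left` end) is the range of `β` (its `right` end). -/
def comp (α β : Quiver.Total X) (h : α.left = β.right) : Quiver.Total X :=
  ⟨β.left, α.right, β.hom ≫ eqToHom h.symm ≫ α.hom⟩

/-- The inverse arrow. -/
def inv (α : Quiver.Total X) : Quiver.Total X :=
  ⟨α.right, α.left, Groupoid.inv α.hom⟩

/-- The unit arrow at an object; it identifies `X` with the unit space. -/
def unit (x : X) : Quiver.Total X := ⟨x, x, 𝟙 x⟩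

/-- `α` and `β` are composable and their product is `γ`. -/
def IsComp (α β γ : Quiver.Total X) : Prop :=
  ∃ h : α.left = β.right, comp α β h = γ

theorem isComp_comp (α β : Quiver.Total X) (h : α.left = β.right) :
    IsComp α β (comp α β h) := ⟨h, rfl⟩

theorem isComp_iff {α β γ : Quiver.Total X} : IsComp α β γ ↔
    ∃ (x y z : X) (g : x ⟶ y) (f : y ⟶ z),
      α = ⟨y, z, f⟩ ∧ β = ⟨x, y, g⟩ ∧ γ = ⟨x, z, g ≫ f⟩ := by
  constructor
  · rintro ⟨h, rfl⟩
    obtain ⟨y, z, f⟩ := α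
    obtain ⟨x, y', g⟩ := β
    dsimp at h
    subst h
    exact ⟨x, y, z, g, f, rfl, rfl, by simp [comp]⟩
  · rintro ⟨x, y, z, g, f, rfl, rfl, rfl⟩
    exact ⟨rfl, by simp [comp]⟩

theorem IsComp.left_eq {α β γ : Quiver.Total X} (h : IsComp α β γ) : γ.left = β.left := by
  obtain ⟨x, y, z, g, f, rfl, rfl, rfl⟩ := isComp_iff.1 h; rfl

theorem IsComp.right_eq {α β γ : Quiver.Total X} (h : IsComp α β γ) : γ.right = α.right := by
  obtain ⟨x, y, z, g, f, rfl, rfl, rfl⟩ := isComp_iff.1 h; rfl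

theorem IsComp.inv {α β γ : Quiver.Total X} (h : IsComp α β γ) :
    IsComp (inv β) (inv α) (inv γ) := by
  obtain ⟨x, y, z, g, f, rfl, rfl, rfl⟩ := isComp_iff.1 h
  exact isComp_iff.2 ⟨z, y, x, _, _, rfl, rfl, by simp [Arr.inv]⟩

theorem IsComp.unique {α β γ γ' : Quiver.Total X} (h : IsComp α β γ) (h' : IsComp α β γ') :
    γ = γ' := by
  obtain ⟨_, rfl⟩ := h
  obtain ⟨_, rfl⟩ := h'
  rfl

theorem IsComp.unique_right {α β β' γ : Quiver.Total X} (h : IsComp α β γ)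
    (h' : IsComp α β' γ) : β = β' := by
  obtain ⟨x, y, z, g, f, rfl, rfl, rfl⟩ := isComp_iff.1 h
  obtain ⟨x', y', z', g', f', h1, rfl, h3⟩ := isComp_iff.1 h'
  injection h1 with h11 h12 h13
  subst h11; subst h12
  have := eq_of_heq h13
  subst this
  injection h3 with h31 h32 h33
  subst h31
  have := eq_of_heq h33
  rw [cancel_mono] at this
  subst this
  rfl

theorem inv_inv (α : Quiver.Total X) : inv (inv α) = α := by
  simp [inv]

theorem inv_injective : Function.Injective (inv : Quiver.Total X → Quiver.Total X) :=
  Function.LeftInverse.injective inv_inv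

/-- `η⁻¹γ` for arrows with the same range. -/
def ldiv (η γ : Quiver.Total X) (h : η.right = γ.right) : Quiver.Total X :=
  comp (inv η) γ h

theorem isComp_ldiv (η γ : Quiver.Total X) (h : η.right = γ.right) :
    IsComp η (ldiv η γ h) γ := by
  obtain ⟨y, z, f⟩ := η
  obtain ⟨x, z', k⟩ := γ
  dsimp at h
  subst h
  refine isComp_iff.2 ⟨x, y, z, k ≫ Groupoid.inv f, f, rfl, ?_, by simp⟩
  simp [ldiv, comp, inv]
  exact Category.comp_id k

theorem isComp_assoc {α β γ δ ε : Quiver.Total X} (h : IsComp α β δ) (h' : IsComp δ γ ε) :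
    ∃ ζ, IsComp β γ ζ ∧ IsComp α ζ ε := by
  obtain ⟨x, y, z, g, f, rfl, rfl, rfl⟩ := isComp_iff.1 h
  obtain ⟨x', y', z', g', f', h1, rfl, rfl⟩ := isComp_iff.1 h'
  injection h1 with h11 h12 h13
  subst h11; subst h12
  have := eq_of_heq h13
  subst this
  exact ⟨⟨x', y, g' ≫ g⟩, isComp_iff.2 ⟨_, _, _, _, _, rfl, rfl, rfl⟩,
    isComp_iff.2 ⟨_, _, _, _, _, rfl, rfl, by simp⟩⟩

theorem isComp_assoc' {α β γ ζ ε : Quiver.Total X} (h : IsComp β γ ζ) (h' : IsComp α ζ ε) :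
    ∃ δ, IsComp α β δ ∧ IsComp δ γ ε := by
  obtain ⟨x, y, z, g, f, rfl, rfl, rfl⟩ := isComp_iff.1 h
  obtain ⟨x', y', z', g', f', rfl, h1, rfl⟩ := isComp_iff.1 h'
  injection h1 with h11 h12 h13
  subst h11; subst h12
  have := eq_of_heq h13
  subst this
  exact ⟨⟨y, z', f ≫ f'⟩, isComp_iff.2 ⟨_, _, _, _, _, rfl, rfl, rfl⟩,
    isComp_iff.2 ⟨_, _, _, _, _, rfl, rfl, by simp⟩⟩

end Arr

/-- The groupoid `X`, with the given topologies on its objects and on its arrows, is an étale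
topological groupoid: composition, inversion and units are continuous, and domain and range are
local homeomorphisms. Then `x ↦ Arr.unit x` is a homeomorphism from `X` onto the set of unit
arrows. -/
class IsEtaleGroupoid (X : Type u) [TopologicalSpace X] [Groupoid.{v} X]
    [TopologicalSpace (Quiver.Total X)] : Prop where
  continuous_comp : Continuous
    fun p : {p : Quiver.Total X × Quiver.Total X // p.1.left = p.2.right} =>
      Arr.comp p.1.1 p.1.2 p.2
  continuous_inv : Continuous (Arr.inv : Quiver.Total X → Quiver.Total X)
  continuous_unit : Continuous (Arr.unit : X → Quiver.Total X)
  isLocalHomeomorph_left : IsLocalHomeomorph (Quiver.Total.left : Quiver.Total X → X)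
  isLocalHomeomorph_right : IsLocalHomeomorph (Quiver.Total.right : Quiver.Total X → X)

/-- Open bisections. -/
structure IsBisection {X : Type u} [TopologicalSpace X] [Groupoid.{v} X]
    [TopologicalSpace (Quiver.Total X)] (U : Set (Quiver.Total X)) : Prop where
  isOpen : IsOpen U
  left : IsOpenEmbedding (U.domRestrict Quiver.Total.left)
  right : IsOpenEmbedding (U.domRestrict Quiver.Total.right)

/-! ## Twists -/

/-- A twist over a topological groupoid: a line bundle over the arrows, that is, a family of
one-dimensional normed spaces with a topology on the total space for which the projection is
continuous and open and addition, scalar multiplication and norm are continuous, together with a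
continuous associative multiplication and a continuous involution. -/
structure Twist (𝕜 : Type) [RCLike 𝕜] (X : Type u) [TopologicalSpace X] [Groupoid.{v} X]
    [TopologicalSpace (Quiver.Total X)] where
  fiber : Quiver.Total X → Type w
  [normedAddCommGroup : ∀ γ, NormedAddCommGroup (fiber γ)]
  [normedSpace : ∀ γ, NormedSpace 𝕜 (fiber γ)]
  finrank_fiber : ∀ γ, Module.finrank 𝕜 (fiber γ) = 1
  [topology : TopologicalSpace (TotalSpace 𝕜 fiber)]
  continuous_proj : Continuous (TotalSpace.proj : TotalSpace 𝕜 fiber → Quiver.Total X)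
  isOpenMap_proj : IsOpenMap (TotalSpace.proj : TotalSpace 𝕜 fiber → Quiver.Total X)
  continuous_add : Continuous fun z : TotalSpace (𝕜 × 𝕜) (fiber ×ᵇ fiber) =>
    (⟨z.proj, z.snd.1 + z.snd.2⟩ : TotalSpace 𝕜 fiber)
  continuous_smul : Continuous fun z : 𝕜 × TotalSpace 𝕜 fiber =>
    (⟨z.2.proj, z.1 • z.2.snd⟩ : TotalSpace 𝕜 fiber)
  continuous_norm : Continuous fun z : TotalSpace 𝕜 fiber => ‖z.snd‖
  /-- The bilinear multiplication maps `L_α × L_β → L_γ`, where `γ = αβ`. -/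
  mul : ∀ {α β γ : Quiver.Total X}, Arr.IsComp α β γ → fiber α →ₗ[𝕜] fiber β →ₗ[𝕜] fiber γ
  continuous_mul : Continuous fun z : {z : TotalSpace 𝕜 fiber × TotalSpace 𝕜 fiber //
      z.1.proj.left = z.2.proj.right} =>
    (⟨Arr.comp z.1.1.proj z.1.2.proj z.2,
      mul (Arr.isComp_comp _ _ z.2) z.1.1.snd z.1.2.snd⟩ : TotalSpace 𝕜 fiber)
  mul_assoc : ∀ {α β γ δ ζ ε : Quiver.Total X} (h₁ : Arr.IsComp α β δ) (h₂ : Arr.IsComp δ γ ε)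
    (h₃ : Arr.IsComp β γ ζ) (h₄ : Arr.IsComp α ζ ε) (a : fiber α) (b : fiber β) (c : fiber γ),
    mul h₂ (mul h₁ a b) c = mul h₄ a (mul h₃ b c)
  norm_mul : ∀ {α β γ : Quiver.Total X} (h : Arr.IsComp α β γ) (a : fiber α) (b : fiber β),
    ‖mul h a b‖ = ‖a‖ * ‖b‖
  /-- The conjugate linear involution maps `L_γ → L_{γ⁻¹}`. -/
  star : ∀ γ : Quiver.Total X, fiber γ →ₛₗ[starRingEnd 𝕜] fiber (Arr.inv γ)
  continuous_star : Continuous fun z : TotalSpace 𝕜 fiber =>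
    (⟨Arr.inv z.proj, star z.proj z.snd⟩ : TotalSpace 𝕜 fiber)
  star_star : ∀ (γ : Quiver.Total X) (z : fiber γ),
    (⟨Arr.inv (Arr.inv γ), star _ (star γ z)⟩ : TotalSpace 𝕜 fiber) = ⟨γ, z⟩
  norm_star : ∀ (γ : Quiver.Total X) (z : fiber γ), ‖star γ z‖ = ‖z‖
  star_mul : ∀ {α β γ : Quiver.Total X} (h : Arr.IsComp α β γ) (a : fiber α) (b : fiber β),
    star γ (mul h a b) = mul h.inv (star β b) (star α a)
  /-- `z z* = |z|²` in `L_{r(γ)} ≅ 𝕜`: the element `z z*` of the one-dimensional algebra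
  `L_{r(γ)}` is `|z|²` times its unit, the unit being the element that acts as the identity
  on every fiber over an arrow with range `r(γ)`. -/
  mul_star_self : ∀ {γ ε δ : Quiver.Total X} (h : Arr.IsComp γ (Arr.inv γ) ε)
    (h' : Arr.IsComp ε δ δ) (z : fiber γ) (b : fiber δ),
    mul h' (mul h z (star γ z)) b = ((‖z‖ : 𝕜) ^ 2) • b

attribute [instance] Twist.normedAddCommGroup Twist.normedSpace Twist.topology

namespace Twist

variable {𝕜 : Type} [RCLike 𝕜] {X : Type u} [TopologicalSpace X] [Groupoid.{v} X]
  [TopologicalSpace (Quiver.Total X)]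

section Basic

variable (L : Twist.{u, v, w} 𝕜 X)

/-- Sections of the bundle, with no continuity required. -/
abbrev Section : Type (max u v w) := ∀ γ : Quiver.Total X, L.fiber γ

theorem mk_mul_eq {α β γ γ' : Quiver.Total X} (h : Arr.IsComp α β γ) (h' : Arr.IsComp α β γ')
    (a : L.fiber α) (b : L.fiber β) :
    (⟨γ, L.mul h a b⟩ : TotalSpace 𝕜 L.fiber) = ⟨γ', L.mul h' a b⟩ := by
  obtain rfl := h.unique h'
  rfl

theorem mk_star_congr {γ γ' : Quiver.Total X} {a : L.fiber γ} {a' : L.fiber γ'}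
    (h : (⟨γ, a⟩ : TotalSpace 𝕜 L.fiber) = ⟨γ', a'⟩) :
    (⟨_, L.star _ a⟩ : TotalSpace 𝕜 L.fiber) = ⟨_, L.star _ a'⟩ := by
  cases h
  rfl

theorem mul_congr {α α' β β' γ : Quiver.Total X} {a : L.fiber α} {a' : L.fiber α'}
    {b : L.fiber β} {b' : L.fiber β'}
    (ha : (⟨α, a⟩ : TotalSpace 𝕜 L.fiber) = ⟨α', a'⟩)
    (hb : (⟨β, b⟩ : TotalSpace 𝕜 L.fiber) = ⟨β', b'⟩) (h : Arr.IsComp α β γ)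
    (h' : Arr.IsComp α' β' γ) : L.mul h a b = L.mul h' a' b' := by
  cases ha
  cases hb
  rfl

/-- `f` is a continuous compactly supported section over `U`, extended by zero outside `U`. -/
structure IsCcOn (U : Set (Quiver.Total X)) (f : L.Section) : Prop where
  continuousOn : ContinuousOn (fun γ => (⟨γ, f γ⟩ : TotalSpace 𝕜 L.fiber)) U
  compact : ∃ K ⊆ U, IsCompact K ∧ ∀ γ ∉ K, f γ = 0

/-- The space `𝔠_c(G, L)` of quasi-continuous compactly supported sections. -/
def Cc : Submodule 𝕜 L.Section :=
  Submodule.span 𝕜 {f | ∃ U, IsBisection U ∧ L.IsCcOn U f}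

/-- The convolution `(f * g)(γ) = ∑_{r(η) = r(γ)} f(η) · g(η⁻¹γ)`. If `f` is in `L.Cc`, then only
finitely many terms of the sum are nonzero. -/
noncomputable def conv (f g : L.Section) : L.Section := fun γ =>
  ∑ᶠ η : {η : Quiver.Total X // η.right = γ.right},
    L.mul (Arr.isComp_ldiv η.1 γ η.2) (f η.1) (g (Arr.ldiv η.1 γ η.2))

/-- The norm `‖f‖_{d*} = sup_x ∑_{d(γ) = x} |f(γ)|`. -/
noncomputable def normD (f : L.Section) : ℝ≥0∞ :=
  ⨆ x : X, ∑' γ : {γ : Quiver.Total X // γ.left = x}, ‖f γ.1‖ₑ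

/-- The norm `‖f‖_{r*} = sup_x ∑_{r(γ) = x} |f(γ)|`. -/
noncomputable def normR (f : L.Section) : ℝ≥0∞ :=
  ⨆ x : X, ∑' γ : {γ : Quiver.Total X // γ.right = x}, ‖f γ.1‖ₑ

/-- The norm `‖f‖_I = max {‖f‖_{d*}, ‖f‖_{r*}}`. -/
noncomputable def normI (f : L.Section) : ℝ≥0∞ := max (L.normD f) (L.normR f)

/-- The norm `‖f‖_max`: the infimum of `∑ ‖f_k‖_∞` over all the ways to write `f` as a finite sum
of continuous compactly supported sections `f_k` over bisections `U_k`. -/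
noncomputable def maxNorm (f : L.Section) : ℝ :=
  sInf {s | ∃ (n : ℕ) (U : Fin n → Set (Quiver.Total X)) (g : Fin n → L.Section),
    (∀ k, IsBisection (U k) ∧ L.IsCcOn (U k) (g k)) ∧ f = ∑ k, g k ∧
      s = ∑ k, ⨆ γ, ‖g k γ‖}

end Basic

/-! ### The convolution algebra -/

section Algebra

variable {L : Twist.{u, v, w} 𝕜 X}

theorem conv_eq_of_unique {f g : L.Section} {α β γ : Quiver.Total X} (h : Arr.IsComp α β γ)
    (hf : ∀ η : Quiver.Total X, η.right = γ.right → f η ≠ 0 → η = α) :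
    L.conv f g γ = L.mul h (f α) (g β) := by
  have hr := h.right_eq
  have hb : β = Arr.ldiv α γ hr.symm := h.unique_right (Arr.isComp_ldiv _ _ _)
  subst hb
  unfold conv
  rw [finsum_eq_single _ (⟨α, hr.symm⟩ : {η : Quiver.Total X // η.right = γ.right})]
  intro η hη
  by_cases h0 : f η.1 = 0
  · simp [h0]
  · exact absurd (Subtype.ext (hf η.1 η.2 h0)) hη

theorem conv_eq_zero {f g : L.Section} {γ : Quiver.Total X}
    (hf : ∀ α β, Arr.IsComp α β γ → f α ≠ 0 → g β = 0) : L.conv f g γ = 0 := by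
  unfold conv
  refine finsum_eq_zero_of_forall_eq_zero fun η => ?_
  by_cases h0 : f η.1 = 0
  · simp [h0]
  · rw [hf _ _ (Arr.isComp_ldiv η.1 γ η.2) h0, map_zero]

theorem IsCcOn.eq_zero {U : Set (Quiver.Total X)} {f : L.Section} (hf : L.IsCcOn U f)
    {γ : Quiver.Total X} (h : γ ∉ U) : f γ = 0 := by
  obtain ⟨K, hK, -, h0⟩ := hf.compact
  exact h0 γ fun h' => h (hK h')

theorem IsCcOn.mem_of_ne {U : Set (Quiver.Total X)} {f : L.Section} (hf : L.IsCcOn U f)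
    {γ : Quiver.Total X} (h : f γ ≠ 0) : γ ∈ U := by
  by_contra h'
  exact h (hf.eq_zero h')

theorem IsCcOn.smul {U : Set (Quiver.Total X)} {f : L.Section} (hf : L.IsCcOn U f) (c : 𝕜) :
    L.IsCcOn U (c • f) := by
  obtain ⟨K, hK, hc, h0⟩ := hf.compact
  refine ⟨?_, K, hK, hc, fun γ hγ => by simp [h0 γ hγ]⟩
  exact L.continuous_smul.comp_continuousOn (continuousOn_const.prodMk hf.continuousOn)

theorem IsCcOn.bddAbove {U : Set (Quiver.Total X)} {f : L.Section} (hf : L.IsCcOn U f) :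
    BddAbove (Set.range fun γ => ‖f γ‖) := by
  obtain ⟨K, hK, hc, h0⟩ := hf.compact
  have hcont : ContinuousOn (fun γ => ‖f γ‖) K :=
    L.continuous_norm.comp_continuousOn (hf.continuousOn.mono hK)
  obtain ⟨C, hC⟩ := hc.bddAbove_image hcont
  refine ⟨max C 0, ?_⟩
  rintro _ ⟨γ, rfl⟩
  by_cases h : γ ∈ K
  · exact le_max_of_le_left (hC ⟨γ, h, rfl⟩)
  · simp [h0 γ h]

theorem _root_.IsBisection.injOn_left {U : Set (Quiver.Total X)} (hU : IsBisection U) :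
    Set.InjOn Quiver.Total.left U :=
  Set.injOn_iff_injective.2 hU.left.injective

theorem _root_.IsBisection.injOn_right {U : Set (Quiver.Total X)} (hU : IsBisection U) :
    Set.InjOn Quiver.Total.right U :=
  Set.injOn_iff_injective.2 hU.right.injective

theorem finite_support_of_mem {f : L.Section} (hf : f ∈ L.Cc) (x : X) :
    {η : Quiver.Total X | η.right = x ∧ f η ≠ 0}.Finite := by
  induction hf using Submodule.span_induction with
  | mem f hf =>
    obtain ⟨U, hU, hfU⟩ := hf
    refine Set.Subsingleton.finite ?_
    rintro η ⟨h1, h2⟩ η' ⟨h1', h2'⟩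
    exact hU.injOn_right (hfU.mem_of_ne h2) (hfU.mem_of_ne h2') (h1.trans h1'.symm)
  | zero => simp
  | add f g _ _ hf hg =>
    refine (hf.union hg).subset ?_
    rintro η ⟨h1, h2⟩
    by_cases h : f η = 0
    · exact Or.inr ⟨h1, fun h' => h2 (by simp [h, h'])⟩
    · exact Or.inl ⟨h1, h⟩
  | smul c f _ hf =>
    refine hf.subset ?_
    rintro η ⟨h1, h2⟩
    exact ⟨h1, fun h' => h2 (by simp [h'])⟩

theorem finite_conv_support {f : L.Section} (hf : f ∈ L.Cc) (g : L.Section)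
    (γ : Quiver.Total X) :
    (Function.support fun η : {η : Quiver.Total X // η.right = γ.right} =>
      L.mul (Arr.isComp_ldiv η.1 γ η.2) (f η.1) (g (Arr.ldiv η.1 γ η.2))).Finite := by
  refine Set.Finite.subset
    ((finite_support_of_mem hf γ.right).preimage Subtype.val_injective.injOn) ?_
  intro η hη
  refine ⟨η.2, fun h => hη ?_⟩
  simp [h]

theorem conv_add_left {f f' : L.Section} (hf : f ∈ L.Cc) (hf' : f' ∈ L.Cc) (g : L.Section) :
    L.conv (f + f') g = L.conv f g + L.conv f' g := by
  funext γ
  simp only [conv, Pi.add_apply]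
  rw [← finsum_add_distrib (finite_conv_support hf g γ) (finite_conv_support hf' g γ)]
  simp

theorem conv_add_right {f : L.Section} (hf : f ∈ L.Cc) (g g' : L.Section) :
    L.conv f (g + g') = L.conv f g + L.conv f g' := by
  funext γ
  simp only [conv, Pi.add_apply]
  rw [← finsum_add_distrib (finite_conv_support hf g γ) (finite_conv_support hf g' γ)]
  simp

theorem conv_smul_left (c : 𝕜) (f g : L.Section) :
    L.conv (c • f) g = c • L.conv f g := by
  funext γ
  simp only [conv, Pi.smul_apply]
  rw [smul_finsum]
  simp

theorem conv_smul_right (c : 𝕜) (f g : L.Section) :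
    L.conv f (c • g) = c • L.conv f g := by
  funext γ
  simp only [conv, Pi.smul_apply]
  rw [smul_finsum]
  simp

theorem conv_zero_left (g : L.Section) : L.conv 0 g = 0 := by
  funext γ
  exact conv_eq_zero fun _ _ _ h => absurd rfl h

theorem conv_zero_right (f : L.Section) : L.conv f 0 = 0 := by
  funext γ
  exact conv_eq_zero fun _ _ _ _ => rfl

/-- The product of two sets of arrows. -/
def _root_.Arr.setMul (U V : Set (Quiver.Total X)) : Set (Quiver.Total X) :=
  {γ | ∃ α ∈ U, ∃ β ∈ V, Arr.IsComp α β γ}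

theorem _root_.IsBisection.exists_section_right {U : Set (Quiver.Total X)} (hU : IsBisection U) :
    IsOpen (Quiver.Total.right '' U) ∧ ∃ s : Quiver.Total.right '' U → Quiver.Total X,
      Continuous s ∧ ∀ x, s x ∈ U ∧ (s x).right = x := by
  have hr : Set.range (U.domRestrict Quiver.Total.right) = Quiver.Total.right '' U :=
    Set.range_domRestrict _ _
  refine ⟨hr ▸ hU.right.isOpen_range, ?_⟩
  rw [← hr]
  let e := hU.right.toIsEmbedding.toHomeomorph
  refine ⟨fun x => (e.symm x).1, continuous_subtype_val.comp e.symm.continuous, fun x => ?_⟩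
  refine ⟨(e.symm x).2, ?_⟩
  exact congrArg Subtype.val (e.apply_symm_apply x)

theorem _root_.IsBisection.exists_section_left {U : Set (Quiver.Total X)} (hU : IsBisection U) :
    IsOpen (Quiver.Total.left '' U) ∧ ∃ s : Quiver.Total.left '' U → Quiver.Total X,
      Continuous s ∧ ∀ x, s x ∈ U ∧ (s x).left = x := by
  have hr : Set.range (U.domRestrict Quiver.Total.left) = Quiver.Total.left '' U :=
    Set.range_domRestrict _ _
  refine ⟨hr ▸ hU.left.isOpen_range, ?_⟩
  rw [← hr]
  let e := hU.left.toIsEmbedding.toHomeomorph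
  refine ⟨fun x => (e.symm x).1, continuous_subtype_val.comp e.symm.continuous, fun x => ?_⟩
  refine ⟨(e.symm x).2, ?_⟩
  exact congrArg Subtype.val (e.apply_symm_apply x)

theorem IsCcOn.conv_apply {U : Set (Quiver.Total X)} {f g : L.Section} (hU : IsBisection U)
    (hf : L.IsCcOn U f) {α β γ : Quiver.Total X} (hα : α ∈ U) (h : Arr.IsComp α β γ) :
    L.conv f g γ = L.mul h (f α) (g β) :=
  conv_eq_of_unique h fun _ hη h0 =>
    hU.injOn_right (hf.mem_of_ne h0) hα (hη.trans h.right_eq)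

section Etale

variable [IsEtaleGroupoid X]

theorem _root_.IsBisection.of_injOn {U : Set (Quiver.Total X)} (hU : IsOpen U)
    (hl : Set.InjOn Quiver.Total.left U) (hr : Set.InjOn Quiver.Total.right U) :
    IsBisection U where
  isOpen := hU
  left := .of_continuous_injective_isOpenMap
    (IsEtaleGroupoid.isLocalHomeomorph_left.continuous.comp continuous_subtype_val)
    (Set.injOn_iff_injective.1 hl)
    (IsEtaleGroupoid.isLocalHomeomorph_left.isOpenMap.comp hU.isOpenMap_subtype_val)
  right := .of_continuous_injective_isOpenMap
    (IsEtaleGroupoid.isLocalHomeomorph_right.continuous.comp continuous_subtype_val)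
    (Set.injOn_iff_injective.1 hr)
    (IsEtaleGroupoid.isLocalHomeomorph_right.isOpenMap.comp hU.isOpenMap_subtype_val)

theorem continuous_left : Continuous (Quiver.Total.left : Quiver.Total X → X) :=
  IsEtaleGroupoid.isLocalHomeomorph_left.continuous

theorem continuous_right : Continuous (Quiver.Total.right : Quiver.Total X → X) :=
  IsEtaleGroupoid.isLocalHomeomorph_right.continuous

theorem isBisection_setMul {U V : Set (Quiver.Total X)} (hU : IsBisection U)
    (hV : IsBisection V) : IsBisection (Arr.setMul U V) := by
  refine IsBisection.of_injOn ?_ ?_ ?_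
  · obtain ⟨ho, s, hs, hsU⟩ := hU.exists_section_right
    let W : Set (Quiver.Total X) := Quiver.Total.right ⁻¹' (Quiver.Total.right '' U)
    have hW : IsOpen W := ho.preimage continuous_right
    let φ : W → Quiver.Total X := fun γ =>
      Arr.ldiv (s ⟨γ.1.right, γ.2⟩) γ.1 (hsU ⟨γ.1.right, γ.2⟩).2
    have hs' : Continuous fun γ : W => s ⟨γ.1.right, γ.2⟩ :=
      hs.comp ((continuous_right.comp continuous_subtype_val).subtype_mk _)
    have hφ : Continuous φ := by
      have h1 : Continuous fun γ : W =>
          (⟨(Arr.inv (s ⟨γ.1.right, γ.2⟩), γ.1), (hsU ⟨γ.1.right, γ.2⟩).2⟩ :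
            {p : Quiver.Total X × Quiver.Total X // p.1.left = p.2.right}) :=
        ((IsEtaleGroupoid.continuous_inv.comp hs').prodMk continuous_subtype_val).subtype_mk _
      exact IsEtaleGroupoid.continuous_comp.comp h1
    have : Arr.setMul U V = Subtype.val '' (φ ⁻¹' V) := by
      ext γ
      constructor
      · rintro ⟨α, hα, β, hβ, h⟩
        have hγ : γ ∈ W := ⟨α, hα, h.right_eq.symm⟩
        refine ⟨⟨γ, hγ⟩, ?_, rfl⟩
        have h1 : s ⟨γ.right, hγ⟩ = α :=
          hU.injOn_right (hsU _).1 hα ((hsU _).2.trans h.right_eq)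
        have h2 : Arr.IsComp α (φ ⟨γ, hγ⟩) γ := by
          have := Arr.isComp_ldiv (s ⟨γ.right, hγ⟩) γ (hsU ⟨γ.right, hγ⟩).2
          exact h1 ▸ this
        change φ ⟨γ, hγ⟩ ∈ V
        rwa [h2.unique_right h]
      · rintro ⟨γ, hγ, rfl⟩
        exact ⟨_, (hsU ⟨γ.1.right, γ.2⟩).1, _, hγ, Arr.isComp_ldiv _ _ _⟩
    rw [this]
    exact hW.isOpenMap_subtype_val _ (hV.isOpen.preimage hφ)
  · rintro γ ⟨α, hα, β, hβ, h⟩ γ' ⟨α', hα', β', hβ', h'⟩ he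
    obtain rfl := hV.injOn_left hβ hβ' (h.left_eq.symm.trans (he.trans h'.left_eq))
    obtain ⟨e, rfl⟩ := h
    obtain ⟨e', rfl⟩ := h'
    obtain rfl := hU.injOn_left hα hα' (e.trans e'.symm)
    rfl
  · rintro γ ⟨α, hα, β, hβ, h⟩ γ' ⟨α', hα', β', hβ', h'⟩ he
    obtain rfl := hU.injOn_right hα hα' (h.right_eq.symm.trans (he.trans h'.right_eq))
    obtain ⟨e, rfl⟩ := h
    obtain ⟨e', rfl⟩ := h'
    obtain rfl := hV.injOn_right hβ hβ' (e.symm.trans e')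
    rfl

theorem isCompact_setMul [T2Space X] {K K' : Set (Quiver.Total X)} (hK : IsCompact K)
    (hK' : IsCompact K') : IsCompact (Arr.setMul K K') := by
  let P : Set (Quiver.Total X × Quiver.Total X) := {p | p.1.left = p.2.right}
  have hP : IsClosed P := isClosed_eq (continuous_left.comp continuous_fst)
    (continuous_right.comp continuous_snd)
  have h1 : IsCompact (Subtype.val ⁻¹' (K ×ˢ K') : Set P) :=
    hP.isClosedEmbedding_subtypeVal.isCompact_preimage (hK.prod hK')
  have h2 := h1.image (IsEtaleGroupoid.continuous_comp (X := X))
  convert h2 using 1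
  ext γ
  constructor
  · rintro ⟨α, hα, β, hβ, h, rfl⟩
    exact ⟨⟨(α, β), h⟩, ⟨hα, hβ⟩, rfl⟩
  · rintro ⟨⟨⟨α, β⟩, h⟩, ⟨hα, hβ⟩, rfl⟩
    exact ⟨α, hα, β, hβ, h, rfl⟩

theorem IsCcOn.conv [T2Space X] {U V : Set (Quiver.Total X)} {f g : L.Section}
    (hU : IsBisection U) (hV : IsBisection V) (hf : L.IsCcOn U f) (hg : L.IsCcOn V g) :
    L.IsCcOn (Arr.setMul U V) (L.conv f g) := by
  constructor
  · obtain ⟨-, s, hs, hsU⟩ := hU.exists_section_right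
    obtain ⟨-, t, ht, htV⟩ := hV.exists_section_left
    rw [continuousOn_iff_continuous_domRestrict]
    have hr : ∀ γ : Arr.setMul U V, γ.1.right ∈ Quiver.Total.right '' U := by
      rintro ⟨γ, α, hα, β, hβ, h⟩
      exact ⟨α, hα, h.right_eq.symm⟩
    have hl : ∀ γ : Arr.setMul U V, γ.1.left ∈ Quiver.Total.left '' V := by
      rintro ⟨γ, α, hα, β, hβ, h⟩
      exact ⟨β, hβ, h.left_eq.symm⟩
    let a : Arr.setMul U V → U := fun γ => ⟨s ⟨_, hr γ⟩, (hsU _).1⟩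
    let b : Arr.setMul U V → V := fun γ => ⟨t ⟨_, hl γ⟩, (htV _).1⟩
    have ha : Continuous a := (hs.comp
      ((continuous_right.comp continuous_subtype_val).subtype_mk _)).subtype_mk _
    have hb : Continuous b := (ht.comp
      ((continuous_left.comp continuous_subtype_val).subtype_mk _)).subtype_mk _
    have hab : ∀ γ, Arr.IsComp (a γ).1 (b γ).1 γ.1 := by
      rintro ⟨γ, α, hα, β, hβ, h⟩
      have h1 : (a ⟨γ, α, hα, β, hβ, h⟩).1 = α :=
        hU.injOn_right (hsU _).1 hα ((hsU _).2.trans h.right_eq)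
      have h2 : (b ⟨γ, α, hα, β, hβ, h⟩).1 = β :=
        hV.injOn_left (htV _).1 hβ ((htV _).2.trans h.left_eq)
      rw [h1, h2]
      exact h
    have hfa := (continuousOn_iff_continuous_domRestrict.1 hf.continuousOn).comp ha
    have hgb := (continuousOn_iff_continuous_domRestrict.1 hg.continuousOn).comp hb
    have hF : Continuous fun γ : Arr.setMul U V =>
        (⟨(⟨(a γ).1, f (a γ).1⟩, ⟨(b γ).1, g (b γ).1⟩), (hab γ).1⟩ :
          {z : TotalSpace 𝕜 L.fiber × TotalSpace 𝕜 L.fiber //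
            z.1.proj.left = z.2.proj.right}) :=
      (hfa.prodMk hgb).subtype_mk _
    refine (L.continuous_mul.comp hF).congr fun γ => ?_
    dsimp only [Function.comp_apply, Set.domRestrict_apply]
    rw [hf.conv_apply hU (a γ).2 (hab γ)]
    exact L.mk_mul_eq _ _ _ _
  · obtain ⟨K, hKU, hK, hK0⟩ := hf.compact
    obtain ⟨K', hKV, hK', hK0'⟩ := hg.compact
    refine ⟨Arr.setMul K K', ?_, isCompact_setMul hK hK', ?_⟩
    · rintro γ ⟨α, hα, β, hβ, h⟩
      exact ⟨α, hKU hα, β, hKV hβ, h⟩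
    · intro γ hγ
      refine conv_eq_zero fun α β h h0 => ?_
      by_contra h0'
      refine hγ ⟨α, ?_, β, ?_, h⟩
      · by_contra hα
        exact h0 (hK0 α hα)
      · by_contra hβ
        exact h0' (hK0' β hβ)

theorem conv_mem [T2Space X] {f g : L.Section} (hf : f ∈ L.Cc) (hg : g ∈ L.Cc) :
    L.conv f g ∈ L.Cc := by
  induction hf using Submodule.span_induction with
  | zero => rw [conv_zero_left]; exact zero_mem _
  | add f f' h1 h2 h h' => rw [conv_add_left h1 h2]; exact add_mem h h'
  | smul c f _ h => rw [conv_smul_left]; exact Submodule.smul_mem _ _ h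
  | mem f hf =>
    have hf' : f ∈ L.Cc := Submodule.subset_span hf
    obtain ⟨U, hU, hfU⟩ := hf
    induction hg using Submodule.span_induction with
    | zero => rw [conv_zero_right]; exact zero_mem _
    | add g g' h1 h2 h h' => rw [conv_add_right hf']; exact add_mem h h'
    | smul c g _ h => rw [conv_smul_right]; exact Submodule.smul_mem _ _ h
    | mem g hg =>
      obtain ⟨V, hV, hgV⟩ := hg
      exact Submodule.subset_span ⟨_, isBisection_setMul hU hV, hfU.conv hU hV hgV⟩

theorem IsCcOn.conv_assoc [T2Space X] {U V : Set (Quiver.Total X)} {f g : L.Section}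
    (hU : IsBisection U) (hV : IsBisection V) (hf : L.IsCcOn U f) (hg : L.IsCcOn V g)
    (h : L.Section) : L.conv (L.conv f g) h = L.conv f (L.conv g h) := by
  funext ε
  by_cases hε : ∃ α ∈ U, ∃ β ∈ V, ∃ γ δ, Arr.IsComp α β δ ∧ Arr.IsComp δ γ ε
  · obtain ⟨α, hα, β, hβ, γ, δ, h1, h2⟩ := hε
    obtain ⟨ζ, h3, h4⟩ := Arr.isComp_assoc h1 h2
    rw [(hf.conv hU hV hg).conv_apply (isBisection_setMul hU hV) ⟨α, hα, β, hβ, h1⟩ h2,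
      hf.conv_apply hU hα h1, hf.conv_apply hU hα h4, hg.conv_apply hV hβ h3]
    exact L.mul_assoc _ _ _ _ _ _ _
  · rw [conv_eq_zero, conv_eq_zero]
    · intro α ζ h1 h0
      refine conv_eq_zero fun β γ h2 h0' => ?_
      obtain ⟨δ, h3, h4⟩ := Arr.isComp_assoc' h2 h1
      exact absurd ⟨α, hf.mem_of_ne h0, β, hg.mem_of_ne h0', γ, δ, h3, h4⟩ hε
    · intro δ γ h1 h0
      obtain ⟨α, hα, β, hβ, h2⟩ := (hf.conv hU hV hg).mem_of_ne h0
      exact absurd ⟨α, hα, β, hβ, γ, δ, h2, h1⟩ hε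

theorem conv_assoc [T2Space X] {f g : L.Section} (hf : f ∈ L.Cc) (hg : g ∈ L.Cc)
    (k : L.Section) : L.conv (L.conv f g) k = L.conv f (L.conv g k) := by
  induction hf using Submodule.span_induction with
  | zero => simp only [conv_zero_left]
  | add f f' h1 h2 h h' =>
    rw [conv_add_left h1 h2, conv_add_left (conv_mem h1 hg) (conv_mem h2 hg), h, h',
      conv_add_left h1 h2]
  | smul c f _ h => rw [conv_smul_left, conv_smul_left, h, conv_smul_left]
  | mem f hf =>
    have hf' : f ∈ L.Cc := Submodule.subset_span hf
    obtain ⟨U, hU, hfU⟩ := hf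
    induction hg using Submodule.span_induction with
    | zero => simp only [conv_zero_left, conv_zero_right]
    | add g g' h1 h2 h h' =>
      rw [conv_add_right hf', conv_add_left (conv_mem hf' h1) (conv_mem hf' h2), h, h',
        conv_add_left h1 h2, conv_add_right hf']
    | smul c g _ h =>
      rw [conv_smul_right, conv_smul_left, h, conv_smul_left, conv_smul_right]
    | mem g hg =>
      obtain ⟨V, hV, hgV⟩ := hg
      exact hfU.conv_assoc hU hV hgV k

end Etale

/-! ### The norm `‖·‖_max` -/

theorem IsCcOn.iSup_conv_le {U V : Set (Quiver.Total X)} {f g : L.Section}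
    (hU : IsBisection U) (hf : L.IsCcOn U f) (hg : L.IsCcOn V g) :
    ⨆ γ, ‖L.conv f g γ‖ ≤ (⨆ γ, ‖f γ‖) * ⨆ γ, ‖g γ‖ := by
  have h0 : 0 ≤ (⨆ γ, ‖f γ‖) * ⨆ γ, ‖g γ‖ :=
    mul_nonneg (Real.iSup_nonneg fun _ => norm_nonneg _) (Real.iSup_nonneg fun _ => norm_nonneg _)
  refine Real.iSup_le (fun γ => ?_) h0
  by_cases h : ∃ α ∈ U, ∃ β, Arr.IsComp α β γ
  · obtain ⟨α, hα, β, h⟩ := h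
    rw [hf.conv_apply hU hα h, L.norm_mul]
    exact mul_le_mul (le_ciSup hf.bddAbove α) (le_ciSup hg.bddAbove β) (norm_nonneg _)
      (Real.iSup_nonneg fun _ => norm_nonneg _)
  · rw [conv_eq_zero fun α β h' h0 => absurd ⟨α, hf.mem_of_ne h0, β, h'⟩ h, norm_zero]
    exact h0

theorem maxNorm_bddBelow (f : L.Section) :
    BddBelow {s | ∃ (n : ℕ) (U : Fin n → Set (Quiver.Total X)) (g : Fin n → L.Section),
    (∀ k, IsBisection (U k) ∧ L.IsCcOn (U k) (g k)) ∧ f = ∑ k, g k ∧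
      s = ∑ k, ⨆ γ, ‖g k γ‖} := by
  refine ⟨0, ?_⟩
  rintro s ⟨n, U, g, -, -, rfl⟩
  exact Finset.sum_nonneg fun k _ => Real.iSup_nonneg fun _ => norm_nonneg _

theorem maxNorm_nonneg (f : L.Section) : 0 ≤ L.maxNorm f := by
  refine Real.sInf_nonneg ?_
  rintro s ⟨n, U, g, -, -, rfl⟩
  exact Finset.sum_nonneg fun k _ => Real.iSup_nonneg fun _ => norm_nonneg _

theorem maxNorm_le {ι : Type*} [Fintype ι] {f : L.Section} (U : ι → Set (Quiver.Total X))
    (g : ι → L.Section) (h : ∀ k, IsBisection (U k) ∧ L.IsCcOn (U k) (g k))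
    (hf : f = ∑ k, g k) : L.maxNorm f ≤ ∑ k, ⨆ γ, ‖g k γ‖ := by
  let e := (Fintype.equivFin ι).symm
  refine csInf_le (maxNorm_bddBelow f) ⟨Fintype.card ι, U ∘ e, g ∘ e, fun k => h _, ?_, ?_⟩
  · rw [hf]
    exact (Equiv.sum_comp e g).symm
  · exact (Equiv.sum_comp e fun k => ⨆ γ, ‖g k γ‖).symm

theorem exists_sum {f : L.Section} (hf : f ∈ L.Cc) :
    ∃ (n : ℕ) (U : Fin n → Set (Quiver.Total X)) (g : Fin n → L.Section),
    (∀ k, IsBisection (U k) ∧ L.IsCcOn (U k) (g k)) ∧ f = ∑ k, g k := by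
  induction hf using Submodule.span_induction with
  | mem f hf =>
    obtain ⟨U, hU, hfU⟩ := hf
    exact ⟨1, fun _ => U, fun _ => f, fun _ => ⟨hU, hfU⟩, by simp⟩
  | zero => exact ⟨0, Fin.elim0, Fin.elim0, fun k => k.elim0, by simp⟩
  | add f f' _ _ h h' =>
    obtain ⟨n, U, g, hg, rfl⟩ := h
    obtain ⟨m, V, g', hg', rfl⟩ := h'
    refine ⟨n + m, Fin.append U V, Fin.append g g', fun k => ?_, by simp [Fin.sum_univ_add]⟩
    refine Fin.addCases (fun i => ?_) (fun i => ?_) k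
    · simpa using hg i
    · simpa using hg' i
  | smul c f _ h =>
    obtain ⟨n, U, g, hg, rfl⟩ := h
    exact ⟨n, U, fun k => c • g k, fun k => ⟨(hg k).1, (hg k).2.smul c⟩, Finset.smul_sum⟩

theorem exists_lt_of_maxNorm_lt {f : L.Section} (hf : f ∈ L.Cc) {t : ℝ} (ht : L.maxNorm f < t) :
    ∃ (n : ℕ) (U : Fin n → Set (Quiver.Total X)) (g : Fin n → L.Section),
    (∀ k, IsBisection (U k) ∧ L.IsCcOn (U k) (g k)) ∧ f = ∑ k, g k ∧
      ∑ k, ⨆ γ, ‖g k γ‖ < t := by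
  obtain ⟨n, U, g, hg, hs⟩ := exists_sum hf
  have hne : {s | ∃ (n : ℕ) (U : Fin n → Set (Quiver.Total X)) (g : Fin n → L.Section),
    (∀ k, IsBisection (U k) ∧ L.IsCcOn (U k) (g k)) ∧ f = ∑ k, g k ∧
      s = ∑ k, ⨆ γ, ‖g k γ‖}.Nonempty := ⟨_, n, U, g, hg, hs, rfl⟩
  obtain ⟨s, ⟨n, U, g, hg, hs, rfl⟩, hlt⟩ := exists_lt_of_csInf_lt hne ht
  exact ⟨n, U, g, hg, hs, hlt⟩

theorem maxNorm_zero : L.maxNorm (0 : L.Section) = 0 := by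
  refine le_antisymm ?_ (maxNorm_nonneg _)
  simpa using maxNorm_le (L := L) (f := 0) (ι := Fin 0) Fin.elim0 Fin.elim0 (fun k => k.elim0)
    (by simp)

theorem maxNorm_add_le {f g : L.Section} (hf : f ∈ L.Cc) (hg : g ∈ L.Cc) :
    L.maxNorm (f + g) ≤ L.maxNorm f + L.maxNorm g := by
  refine le_of_forall_pos_lt_add fun ε hε => ?_
  obtain ⟨n, U, a, ha, rfl, ha'⟩ :=
    exists_lt_of_maxNorm_lt hf (show L.maxNorm f < L.maxNorm f + ε / 2 by linarith)
  obtain ⟨m, V, b, hb, rfl, hb'⟩ :=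
    exists_lt_of_maxNorm_lt hg (show L.maxNorm g < L.maxNorm g + ε / 2 by linarith)
  have := maxNorm_le (L := L) (f := ∑ k, a k + ∑ k, b k) (Sum.elim U V) (Sum.elim a b)
    (by rintro (k | k); exacts [ha k, hb k]) (by simp)
  simp only [Fintype.sum_sum_type, Sum.elim_inl, Sum.elim_inr] at this
  linarith

theorem maxNorm_smul_le {f : L.Section} (hf : f ∈ L.Cc) (c : 𝕜) :
    L.maxNorm (c • f) ≤ ‖c‖ * L.maxNorm f := by
  refine le_of_forall_pos_lt_add fun ε hε => ?_
  have hc : 0 < ‖c‖ + 1 := by positivity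
  obtain ⟨n, U, a, ha, rfl, ha'⟩ := exists_lt_of_maxNorm_lt hf
    (show L.maxNorm f < L.maxNorm f + ε / (‖c‖ + 1) by have := div_pos hε hc; linarith)
  refine (maxNorm_le U (fun k => c • a k) (fun k => ⟨(ha k).1, (ha k).2.smul c⟩)
    Finset.smul_sum).trans_lt ?_
  have h1 : ∀ k, ⨆ γ, ‖(c • a k) γ‖ = ‖c‖ * ⨆ γ, ‖a k γ‖ := fun k => by
    rw [Real.mul_iSup_of_nonneg (norm_nonneg c)]
    simp [norm_smul]
  simp only [h1, ← Finset.mul_sum]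
  have h2 : ‖c‖ * (ε / (‖c‖ + 1)) < ε := by
    rw [← mul_div_assoc, div_lt_iff₀ hc]
    nlinarith
  have h3 := mul_le_mul_of_nonneg_left ha'.le (norm_nonneg c)
  rw [mul_add] at h3
  linarith

theorem maxNorm_neg {f : L.Section} (hf : f ∈ L.Cc) : L.maxNorm (-f) = L.maxNorm f := by
  have h : ∀ {g : L.Section}, g ∈ L.Cc → L.maxNorm (-g) ≤ L.maxNorm g := fun {g} hg => by
    simpa using maxNorm_smul_le hg (-1 : 𝕜)
  exact le_antisymm (h hf) (by simpa using h (neg_mem hf))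

theorem maxNorm_conv_le [IsEtaleGroupoid X] [T2Space X] {f g : L.Section} (hf : f ∈ L.Cc)
    (hg : g ∈ L.Cc) : L.maxNorm (L.conv f g) ≤ L.maxNorm f * L.maxNorm g := by
  have key : ∀ s > L.maxNorm f, ∀ t > L.maxNorm g, L.maxNorm (L.conv f g) ≤ s * t := by
    intro s hs t ht
    obtain ⟨n, U, a, ha, hfa, ha'⟩ := exists_lt_of_maxNorm_lt hf hs
    obtain ⟨m, V, b, hb, hgb, hb'⟩ := exists_lt_of_maxNorm_lt hg ht
    have hmem : ∀ k, a k ∈ L.Cc := fun k => Submodule.subset_span (Exists.intro (U k) (ha k))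
    have hsum : L.conv f g = ∑ p : Fin n × Fin m, L.conv (a p.1) (b p.2) := by
      have h1 : ∀ T : Finset (Fin n), L.conv (∑ k ∈ T, a k) g = ∑ k ∈ T, L.conv (a k) g := by
        intro T
        induction T using Finset.induction_on with
        | empty => simp [conv_zero_left]
        | insert i T hi ih =>
          rw [Finset.sum_insert hi, Finset.sum_insert hi,
            conv_add_left (hmem i) (sum_mem fun k _ => hmem k), ih]
      have h2 : ∀ (k : Fin n) (T : Finset (Fin m)),
          L.conv (a k) (∑ j ∈ T, b j) = ∑ j ∈ T, L.conv (a k) (b j) := by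
        intro k T
        induction T using Finset.induction_on with
        | empty => simp [conv_zero_right]
        | insert i T hi ih =>
          rw [Finset.sum_insert hi, Finset.sum_insert hi, conv_add_right (hmem k), ih]
      rw [Fintype.sum_prod_type]
      conv_lhs => rw [hfa, h1]
      refine Finset.sum_congr rfl fun k _ => ?_
      rw [hgb, h2]
    refine (maxNorm_le (fun p : Fin n × Fin m => Arr.setMul (U p.1) (V p.2)) _ (fun p =>
      ⟨isBisection_setMul (ha p.1).1 (hb p.2).1,
        (ha p.1).2.conv (ha p.1).1 (hb p.2).1 (hb p.2).2⟩) hsum).trans ?_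
    calc ∑ p : Fin n × Fin m, ⨆ γ, ‖L.conv (a p.1) (b p.2) γ‖
        ≤ ∑ p : Fin n × Fin m, (⨆ γ, ‖a p.1 γ‖) * ⨆ γ, ‖b p.2 γ‖ :=
          Finset.sum_le_sum fun p _ => (ha p.1).2.iSup_conv_le (ha p.1).1 (hb p.2).2
      _ = (∑ k, ⨆ γ, ‖a k γ‖) * ∑ k, ⨆ γ, ‖b k γ‖ := by
          rw [Fintype.sum_prod_type, Finset.sum_mul_sum]
      _ ≤ s * t := by
          refine mul_le_mul ha'.le hb'.le ?_ ((maxNorm_nonneg f).trans hs.le)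
          exact Finset.sum_nonneg fun k _ => Real.iSup_nonneg fun _ => norm_nonneg _
  have h1 : ∀ s > L.maxNorm f, L.maxNorm (L.conv f g) ≤ s * L.maxNorm g := by
    intro s hs
    have hs0 : 0 < s := (maxNorm_nonneg f).trans_lt hs
    rw [← div_le_iff₀' hs0]
    refine le_of_forall_gt_imp_ge_of_dense fun t ht => ?_
    rw [div_le_iff₀' hs0]
    exact key s hs t ht
  have hcont : Continuous fun s : ℝ => s * L.maxNorm g := by fun_prop
  refine ge_of_tendsto (hcont.continuousWithinAt (s := Set.Ioi (L.maxNorm f)) (x := L.maxNorm f))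
    ?_
  filter_upwards [self_mem_nhdsWithin] with s hs using h1 s hs

end Algebra
end Twist

/-! ## Completion of a non-unital normed algebra -/

namespace NonUnitalCompletion

open UniformSpace

variable {A : Type*} [NonUnitalSeminormedRing A]

noncomputable instance mul : Mul (Completion A) :=
  ⟨Function.curry <| (Completion.isDenseInducing_coe.prodMap Completion.isDenseInducing_coe).extend
    ((↑) ∘ Function.uncurry (· * ·))⟩

theorem coe_mul (a b : A) : ((a * b : A) : Completion A) = a * b :=
  ((Completion.isDenseInducing_coe.prodMap Completion.isDenseInducing_coe).extend_eq
    ((Completion.continuous_coe A).comp (continuous_mul (M := A))) (a, b)).symm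

instance : ContinuousMul (Completion A) where
  continuous_mul := by
    let m := (AddMonoidHom.mul : A →+ A →+ A).compr₂ Completion.toCompl
    have : Continuous fun p : A × A => m p.1 p.2 :=
      (Completion.continuous_coe A).comp (continuous_mul (M := A))
    have di : IsDenseInducing (Completion.toCompl : A → Completion A) :=
      Completion.isDenseInducing_coe
    exact di.extend_Z_bilin di this

noncomputable instance nonUnitalNormedRing : NonUnitalNormedRing (Completion A) where
  __ : NormedAddCommGroup (Completion A) := inferInstance
  __ : Mul (Completion A) := inferInstance
  zero_mul a := Completion.induction_on a (isClosed_eq (by fun_prop) continuous_const)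
    fun a => by rw [← Completion.coe_zero, ← coe_mul, zero_mul]
  mul_zero a := Completion.induction_on a (isClosed_eq (by fun_prop) continuous_const)
    fun a => by rw [← Completion.coe_zero, ← coe_mul, mul_zero]
  mul_assoc a b c := Completion.induction_on₃ a b c (isClosed_eq (by fun_prop) (by fun_prop))
    fun a b c => by rw [← coe_mul, ← coe_mul, ← coe_mul, ← coe_mul, mul_assoc]
  left_distrib a b c := Completion.induction_on₃ a b c (isClosed_eq (by fun_prop) (by fun_prop))
    fun a b c => by
      rw [← Completion.coe_add, ← coe_mul, ← coe_mul, ← coe_mul, ← Completion.coe_add, mul_add]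
  right_distrib a b c := Completion.induction_on₃ a b c (isClosed_eq (by fun_prop) (by fun_prop))
    fun a b c => by
      rw [← Completion.coe_add, ← coe_mul, ← coe_mul, ← coe_mul, ← Completion.coe_add, add_mul]
  norm_mul_le a b := Completion.induction_on₂ a b (isClosed_le (by fun_prop) (by fun_prop))
    fun a b => by
      rw [← coe_mul, Completion.norm_coe, Completion.norm_coe, Completion.norm_coe]
      exact norm_mul_le a b

end NonUnitalCompletion

/-! ## The algebra `F(G, L)` and the regular representation -/

namespace Twist

section

variable {𝕜 : Type} [RCLike 𝕜] {X : Type u} [TopologicalSpace X] [Groupoid.{v} X]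
  [TopologicalSpace (Quiver.Total X)]

/-- The convolution algebra `𝔠_c(G, L)`, normed by `‖·‖_max`. -/
def CcAlg (L : Twist.{u, v, w} 𝕜 X) : Type (max u v w) := L.Cc

instance (L : Twist.{u, v, w} 𝕜 X) : AddCommGroup L.CcAlg := inferInstanceAs (AddCommGroup L.Cc)

noncomputable instance (L : Twist.{u, v, w} 𝕜 X) : Module 𝕜 L.CcAlg :=
  inferInstanceAs (Module 𝕜 L.Cc)

/-- The section underlying an element of the convolution algebra. -/
def CcAlg.val {L : Twist.{u, v, w} 𝕜 X} (f : L.CcAlg) : L.Section := Subtype.val f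

theorem CcAlg.mem {L : Twist.{u, v, w} 𝕜 X} (f : L.CcAlg) : f.val ∈ L.Cc := Subtype.property f

theorem CcAlg.ext {L : Twist.{u, v, w} 𝕜 X} {f g : L.CcAlg} (h : f.val = g.val) : f = g :=
  Subtype.ext h

/-- The element of the convolution algebra given by a section in `L.Cc`. -/
def CcAlg.mk {L : Twist.{u, v, w} 𝕜 X} (f : L.Section) (hf : f ∈ L.Cc) : L.CcAlg := ⟨f, hf⟩

variable (L : Twist.{u, v, w} 𝕜 X) [IsEtaleGroupoid X] [T2Space X]

noncomputable instance : NonUnitalRing L.CcAlg where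
  __ : AddCommGroup L.CcAlg := inferInstance
  mul f g := CcAlg.mk (L.conv f.val g.val) (conv_mem f.mem g.mem)
  left_distrib f g h := CcAlg.ext (conv_add_right f.mem g.val h.val)
  right_distrib f g h := CcAlg.ext (conv_add_left f.mem g.mem h.val)
  zero_mul f := CcAlg.ext (conv_zero_left f.val)
  mul_zero f := CcAlg.ext (conv_zero_right f.val)
  mul_assoc f g h := CcAlg.ext (conv_assoc f.mem g.mem h.val)

theorem CcAlg.val_mul (f g : L.CcAlg) : (f * g).val = L.conv f.val g.val := rfl

noncomputable instance : NonUnitalSeminormedRing L.CcAlg where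
  __ := AddGroupSeminorm.toSeminormedAddCommGroup (E := L.CcAlg)
    { toFun := fun f => L.maxNorm f.val
      map_zero' := maxNorm_zero
      add_le' := fun f g => maxNorm_add_le f.mem g.mem
      neg' := fun f => maxNorm_neg f.mem }
  __ : NonUnitalRing L.CcAlg := inferInstance
  norm_mul_le f g := maxNorm_conv_le f.mem g.mem

theorem CcAlg.norm_def (f : L.CcAlg) : ‖f‖ = L.maxNorm f.val := rfl

noncomputable instance : NormedSpace 𝕜 L.CcAlg where
  norm_smul_le c f := maxNorm_smul_le f.mem c

/-- The groupoid Banach algebra `F(G, L)`, the completion of the convolution algebra in the norm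
`‖·‖_max`. -/
abbrev BanachAlg : Type (max u v w) := UniformSpace.Completion L.CcAlg

/-- The inclusion of the convolution algebra into its completion. -/
noncomputable def toBanachAlg : L.CcAlg →ₙₐ[𝕜] L.BanachAlg where
  toFun f := (f : UniformSpace.Completion L.CcAlg)
  map_smul' c f := UniformSpace.Completion.coe_smul c f
  map_zero' := UniformSpace.Completion.coe_zero
  map_add' f g := UniformSpace.Completion.coe_add f g
  map_mul' f g := NonUnitalCompletion.coe_mul f g

/-- The Banach space `ℓ^p(G, L)` of `p`-summable (for `p = ∞`, bounded) sections. -/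
abbrev ellP (p : ℝ≥0∞) : Type (max u v w) := lp L.fiber p

variable {L}

/-- `Λ` is the left regular representation of `F(G, L)` on `ℓ^p(G, L)`: a contractive
homomorphism such that `Λ(f)ξ = f * ξ` for `f ∈ 𝔠_c(G, L)`. -/
structure IsRegularRep {p : ℝ≥0∞} [Fact (1 ≤ p)]
    (Λ : L.BanachAlg →ₙₐ[𝕜] (L.ellP p →L[𝕜] L.ellP p)) : Prop where
  norm_le : ∀ a, ‖Λ a‖ ≤ ‖a‖
  apply_eq : ∀ (f : L.CcAlg) (ξ : L.ellP p),
    (Λ (L.toBanachAlg f) ξ : ∀ γ, L.fiber γ) = L.conv f.val ξ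

/-- The closure of the image of `𝔠_c(G, L)` under a representation of `F(G, L)`; for the regular
representation on `ℓ^p(G, L)` this is `F^p_red(G, L)`. -/
noncomputable def closedImage {E : Type*} [NormedAddCommGroup E] [NormedSpace 𝕜 E]
    (Λ : L.BanachAlg →ₙₐ[𝕜] (E →L[𝕜] E)) : NonUnitalSubalgebra 𝕜 (E →L[𝕜] E) :=
  (NonUnitalAlgHom.range (Λ.comp L.toBanachAlg)).topologicalClosure

/-- The operator `Λ(f)`, for `f ∈ 𝔠_c(G, L)`, as an element of `closedImage Λ`. -/
noncomputable def toClosedImage {E : Type*} [NormedAddCommGroup E] [NormedSpace 𝕜 E]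
    (Λ : L.BanachAlg →ₙₐ[𝕜] (E →L[𝕜] E)) (f : L.CcAlg) : closedImage Λ :=
  ⟨Λ (L.toBanachAlg f), NonUnitalSubalgebra.le_topologicalClosure _ ⟨f, rfl⟩⟩

end

/-! ## Opposite and trivial twists -/

section Op

variable {𝕜 : Type} [RCLike 𝕜] {X : Type u} [TopologicalSpace X] [Groupoid.{v} X]
  [TopologicalSpace (Quiver.Total X)]

/-- The map `(γ, z) ↦ (γ⁻¹, z)` from the bundle with fibers `L_{γ⁻¹}` to `L`. -/
def flip (L : Twist.{u, v, w} 𝕜 X) (z : TotalSpace 𝕜 fun γ => L.fiber (Arr.inv γ)) :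
    TotalSpace 𝕜 L.fiber := ⟨Arr.inv z.proj, z.snd⟩

theorem flip_bijective (L : Twist.{u, v, w} 𝕜 X) : Function.Bijective L.flip := by
  constructor
  · rintro ⟨γ, z⟩ ⟨γ', z'⟩ h
    have h1 : Arr.inv γ = Arr.inv γ' := congrArg TotalSpace.proj h
    obtain rfl := Arr.inv_injective h1
    have h2 : (⟨Arr.inv γ, z⟩ : TotalSpace 𝕜 L.fiber) = ⟨Arr.inv γ, z'⟩ := h
    simp only [TotalSpace.mk.injEq, heq_eq_eq, true_and] at h2
    rw [h2]
  · rintro ⟨γ, z⟩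
    obtain ⟨γ, rfl⟩ : ∃ γ', γ = Arr.inv γ' := ⟨Arr.inv γ, (Arr.inv_inv γ).symm⟩
    exact ⟨⟨γ, z⟩, rfl⟩

variable [IsEtaleGroupoid X]

/-- The opposite twist: the fiber over `γ` is `L_{γ⁻¹}`, the total space is topologized so that
it is homeomorphic to the total space of `L` in the obvious way, the product of `z` and `w` is
`w · z`, and the involution is that of `L`. -/
def op (L : Twist.{u, v, w} 𝕜 X) : Twist.{u, v, w} 𝕜 X :=
  letI top : TopologicalSpace (TotalSpace 𝕜 fun γ => L.fiber (Arr.inv γ)) :=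
    TopologicalSpace.induced L.flip inferInstance
  have hfl : IsInducing L.flip := ⟨rfl⟩
  { fiber := fun γ => L.fiber (Arr.inv γ)
    normedAddCommGroup := fun γ => L.normedAddCommGroup (Arr.inv γ)
    normedSpace := fun γ => L.normedSpace (Arr.inv γ)
    finrank_fiber := fun γ => L.finrank_fiber (Arr.inv γ)
    topology := top
    continuous_proj := by
      refine ((IsEtaleGroupoid.continuous_inv.comp L.continuous_proj).comp hfl.continuous).congr ?_
      exact fun z => Arr.inv_inv _
    isOpenMap_proj := by
      intro U hU
      obtain ⟨V, hV, rfl⟩ := isOpen_induced_iff.1 hU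
      have : TotalSpace.proj '' (L.flip ⁻¹' V) = Arr.inv ⁻¹' (TotalSpace.proj '' V) := by
        ext γ
        constructor
        · rintro ⟨z, hz, rfl⟩
          exact ⟨L.flip z, hz, rfl⟩
        · rintro ⟨z, hz, h⟩
          obtain ⟨z, rfl⟩ := L.flip_bijective.2 z
          exact ⟨z, hz, Arr.inv_injective h⟩
      rw [this]
      exact (L.isOpenMap_proj V hV).preimage IsEtaleGroupoid.continuous_inv
    continuous_add := by
      rw [hfl.continuous_iff]
      let ψ : TotalSpace (𝕜 × 𝕜) ((fun γ => L.fiber (Arr.inv γ)) ×ᵇ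
          fun γ => L.fiber (Arr.inv γ)) → TotalSpace (𝕜 × 𝕜) (L.fiber ×ᵇ L.fiber) :=
        fun z => ⟨Arr.inv z.proj, z.snd⟩
      have hψ : Continuous ψ := by
        rw [(FiberBundle.Prod.isInducing_diag 𝕜 L.fiber 𝕜 L.fiber).continuous_iff]
        have h1 := (FiberBundle.Prod.isInducing_diag 𝕜 (fun γ => L.fiber (Arr.inv γ)) 𝕜
          (fun γ => L.fiber (Arr.inv γ))).continuous
        exact (hfl.continuous.prodMap hfl.continuous).comp h1
      exact L.continuous_add.comp hψ
    continuous_smul := by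
      rw [hfl.continuous_iff]
      exact L.continuous_smul.comp (continuous_id.prodMap hfl.continuous)
    continuous_norm := L.continuous_norm.comp hfl.continuous
    mul := fun h => (L.mul h.inv).flip
    continuous_mul := by
      rw [hfl.continuous_iff]
      let ψ : {z : TotalSpace 𝕜 (fun γ => L.fiber (Arr.inv γ)) ×
          TotalSpace 𝕜 (fun γ => L.fiber (Arr.inv γ)) // z.1.proj.left = z.2.proj.right} →
          {z : TotalSpace 𝕜 L.fiber × TotalSpace 𝕜 L.fiber // z.1.proj.left = z.2.proj.right} :=
        fun z => ⟨(L.flip z.1.2, L.flip z.1.1), z.2.symm⟩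
      have hψ : Continuous ψ := by
        refine Continuous.subtype_mk (Continuous.prodMk ?_ ?_) _
        · exact hfl.continuous.comp (continuous_snd.comp continuous_subtype_val)
        · exact hfl.continuous.comp (continuous_fst.comp continuous_subtype_val)
      refine (L.continuous_mul.comp hψ).congr fun z => ?_
      exact L.mk_mul_eq _ _ _ _
    mul_assoc := fun h₁ h₂ h₃ h₄ a b c =>
      (L.mul_assoc h₃.inv h₄.inv h₁.inv h₂.inv c b a).symm
    norm_mul := fun h a b => (L.norm_mul h.inv b a).trans (mul_comm _ _)
    star := fun γ => L.star (Arr.inv γ)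
    continuous_star := by
      rw [hfl.continuous_iff]
      exact L.continuous_star.comp hfl.continuous
    star_star := fun γ z => L.flip_bijective.1 (L.star_star (Arr.inv γ) z)
    norm_star := fun γ z => L.norm_star (Arr.inv γ) z
    star_mul := fun h a b => L.star_mul h.inv b a
    mul_star_self := by
      intro γ ε δ h h' z b
      have hinj : Function.Injective (L.star (Arr.inv δ)) :=
        (injective_iff_map_eq_zero _).2 fun a ha => by
          rw [← norm_eq_zero, ← L.norm_star, ha, norm_zero]
      apply hinj
      change L.star _ (L.mul h'.inv b (L.mul h.inv (L.star _ z) z)) = L.star _ (_ • b)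
      rw [L.star_mul, L.star_mul, L.mul_star_self, L.norm_star, LinearMap.map_smulₛₗ]
      simp }

/-- The map `f ↦ f̌`, `f̌(γ) = f(γ⁻¹)`, from sections of `L` to sections of the opposite twist. -/
def check (L : Twist.{u, v, w} 𝕜 X) (f : L.Section) : L.op.Section := fun γ => f (Arr.inv γ)

theorem check_mem (L : Twist.{u, v, w} 𝕜 X) {f : L.Section} (hf : f ∈ L.Cc) :
    L.check f ∈ L.op.Cc := by
  induction hf using Submodule.span_induction with
  | zero => exact zero_mem L.op.Cc
  | add f g _ _ hf hg => exact add_mem hf hg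
  | smul c f _ hf => exact Submodule.smul_mem L.op.Cc c hf
  | mem f hf =>
    obtain ⟨U, hU, hfU⟩ := hf
    refine Submodule.subset_span ⟨Arr.inv ⁻¹' U, ?_, ?_, ?_⟩
    · refine IsBisection.of_injOn (hU.isOpen.preimage IsEtaleGroupoid.continuous_inv) ?_ ?_
      · intro γ hγ γ' hγ' h
        exact Arr.inv_injective (hU.injOn_right hγ hγ' h)
      · intro γ hγ γ' hγ' h
        exact Arr.inv_injective (hU.injOn_left hγ hγ' h)
    · have hfl : IsInducing L.flip (tX := L.op.topology) := ⟨rfl⟩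
      refine (hfl.continuousOn_iff (f := fun γ => (⟨γ, L.check f γ⟩ :
        TotalSpace 𝕜 L.op.fiber))).2 ?_
      exact hfU.continuousOn.comp IsEtaleGroupoid.continuous_inv.continuousOn fun _ h => h
    · obtain ⟨K, hKU, hK, h0⟩ := hfU.compact
      refine ⟨Arr.inv '' K, ?_, hK.image IsEtaleGroupoid.continuous_inv, fun γ hγ => h0 _ ?_⟩
      · rintro _ ⟨γ, hγ, rfl⟩
        change Arr.inv (Arr.inv γ) ∈ U
        rw [Arr.inv_inv]
        exact hKU hγ
      · exact fun h => hγ ⟨_, h, Arr.inv_inv γ⟩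

/-- The map `f ↦ f̌` on the convolution algebra. -/
def CcAlg.check {L : Twist.{u, v, w} 𝕜 X} (f : L.CcAlg) : L.op.CcAlg :=
  CcAlg.mk (L.check f.val) (L.check_mem f.mem)

end Op

section Trivial

theorem trivial_inducing (𝕜 : Type) [RCLike 𝕜] (X : Type u) [Groupoid.{v} X]
    [TopologicalSpace (Quiver.Total X)] :
    IsInducing fun z : TotalSpace 𝕜 (Bundle.Trivial (Quiver.Total X) 𝕜) =>
    ((z.proj, z.snd) : Quiver.Total X × 𝕜) :=
  Bundle.Trivial.isInducing_toProd (Quiver.Total X) 𝕜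

variable (𝕜 : Type) [RCLike 𝕜] (X : Type u) [TopologicalSpace X] [Groupoid.{v} X]
  [TopologicalSpace (Quiver.Total X)] [IsEtaleGroupoid X]

/-- The trivial twist `G × 𝕜` with pointwise operations. -/
def trivial : Twist.{u, v, 0} 𝕜 X where
  fiber := Bundle.Trivial (Quiver.Total X) 𝕜
  normedAddCommGroup := fun _ => inferInstanceAs (NormedAddCommGroup 𝕜)
  normedSpace := fun _ => inferInstanceAs (NormedSpace 𝕜 𝕜)
  finrank_fiber := fun _ => Module.finrank_self 𝕜
  topology := inferInstance
  continuous_proj := continuous_fst.comp (trivial_inducing 𝕜 X).continuous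
  isOpenMap_proj :=
    isOpenMap_fst.comp (Bundle.Trivial.homeomorphProd (Quiver.Total X) 𝕜).isOpenMap
  continuous_add := by
    rw [(trivial_inducing 𝕜 X).continuous_iff]
    have h := (FiberBundle.Prod.isInducing_diag 𝕜 (Bundle.Trivial (Quiver.Total X) 𝕜) 𝕜
      (Bundle.Trivial (Quiver.Total X) 𝕜)).continuous
    have h1 := (trivial_inducing 𝕜 X).continuous.comp (continuous_fst.comp h)
    have h2 := (trivial_inducing 𝕜 X).continuous.comp (continuous_snd.comp h)
    have h3 : Continuous fun z : TotalSpace (𝕜 × 𝕜) (Bundle.Trivial (Quiver.Total X) 𝕜 ×ᵇ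
        Bundle.Trivial (Quiver.Total X) 𝕜) => (z.snd.1 : 𝕜) := h1.snd
    have h4 : Continuous fun z : TotalSpace (𝕜 × 𝕜) (Bundle.Trivial (Quiver.Total X) 𝕜 ×ᵇ
        Bundle.Trivial (Quiver.Total X) 𝕜) => (z.snd.2 : 𝕜) := h2.snd
    exact (continuous_fst.comp h1).prodMk (h3.add h4)
  continuous_smul := by
    rw [(trivial_inducing 𝕜 X).continuous_iff]
    have h := (trivial_inducing 𝕜 X).continuous.comp
      (continuous_snd (X := 𝕜) (Y := TotalSpace 𝕜 (Bundle.Trivial (Quiver.Total X) 𝕜)))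
    exact (continuous_fst.comp h).prodMk (continuous_fst.mul (continuous_snd.comp h))
  continuous_norm :=
    (_root_.continuous_norm (E := 𝕜)).comp
      (continuous_snd.comp (trivial_inducing 𝕜 X).continuous)
  mul := fun _ => LinearMap.mul 𝕜 𝕜
  continuous_mul := by
    rw [(trivial_inducing 𝕜 X).continuous_iff]
    have h := (trivial_inducing 𝕜 X).continuous
    have h1 := h.comp (continuous_fst.comp (continuous_subtype_val
      (p := fun z : TotalSpace 𝕜 (Bundle.Trivial (Quiver.Total X) 𝕜) ×
        TotalSpace 𝕜 (Bundle.Trivial (Quiver.Total X) 𝕜) => z.1.proj.left = z.2.proj.right)))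
    have h2 := h.comp (continuous_snd.comp (continuous_subtype_val
      (p := fun z : TotalSpace 𝕜 (Bundle.Trivial (Quiver.Total X) 𝕜) ×
        TotalSpace 𝕜 (Bundle.Trivial (Quiver.Total X) 𝕜) => z.1.proj.left = z.2.proj.right)))
    refine Continuous.prodMk ?_ ((continuous_snd.comp h1).mul (continuous_snd.comp h2))
    exact IsEtaleGroupoid.continuous_comp.comp
      (((continuous_fst.comp h1).prodMk (continuous_fst.comp h2)).subtype_mk fun z => z.2)
  mul_assoc := fun _ _ _ _ a b c => _root_.mul_assoc (G := 𝕜) a b c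
  norm_mul := fun _ a b => _root_.norm_mul (α := 𝕜) a b
  star := fun _ => (starLinearEquiv 𝕜 (A := 𝕜)).toLinearMap
  continuous_star := by
    rw [(trivial_inducing 𝕜 X).continuous_iff]
    have h := (trivial_inducing 𝕜 X).continuous
    exact (IsEtaleGroupoid.continuous_inv.comp (continuous_fst.comp h)).prodMk
      (RCLike.continuous_conj.comp (continuous_snd.comp h))
  star_star := by
    intro γ z
    have h := Arr.inv_inv γ
    have hz : starRingEnd 𝕜 (starRingEnd 𝕜 z) = z := RCLike.conj_conj (R := 𝕜) z
    exact (Bundle.TotalSpace.toProd (Quiver.Total X) 𝕜).injective (Prod.ext h hz)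
  norm_star := fun _ z => RCLike.norm_conj (K := 𝕜) z
  star_mul := fun _ a b => (map_mul (starRingEnd 𝕜) (a : 𝕜) b).trans (mul_comm _ _)
  mul_star_self := fun _ _ z b =>
    congrArg (fun c : 𝕜 => c * b) (RCLike.mul_conj (K := 𝕜) z)

end Trivial
end Twist

-- Boundedness is a Schur test. For `f` in `L.Cc` and finite `p`, Hölder's inequality with weights
-- `|f(η)|` bounds `|(f * ξ)(γ)|^p` by `‖f‖_{r*}^{p-1} ∑_η |f(η)| |ξ(η⁻¹γ)|^p`. Summing over `γ` and
-- regrouping by `β = η⁻¹γ` leaves, for each `β`, the sum of `|f|` over the arrows with domain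
-- `r(β)`, which is at most `‖f‖_{d*}`. The `p`-th root gives `‖f‖_{d*}^{1/p} ‖f‖_{r*}^{1/q}`
-- (`exists_norm_conv_le`); for `p = ∞` the pointwise estimate suffices. A bisection meets each
-- fiber of `d` or `r` at most once, so `‖f‖_I ≤ ‖f‖_max`. Hence convolution is contractive for
-- `‖·‖_max` and extends to the completion, uniquely by density.
--
-- Injectivity and the `ℓ^1` norm come from point masses at units. If `e` is a unit vector over the
-- unit at `x`, then `f * e` takes the value `f(γ) · e`, of norm `|f(γ)|`, at each `γ` with `d(γ) =
-- x`. So `f` can be read off, and `‖Λ_1(f)‖ ≥ ‖f‖_{d*}`.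
--
-- Duality rests on pairing `L_{γ⁻¹}` with `L_γ` by `(a, b) ↦ φ(a · b)`, where `φ` is a
-- norm-preserving functional on the one-dimensional fiber over the unit at `d(γ)`. Associativity
-- makes convolution by `f̌` adjoint to convolution by `f`. Since the norm of `ℓ^q` is detected by
-- finitely supported vectors of `ℓ^p` even when these are not dense
-- (`lp.norm_le_of_forall_pairing_le`), adjoint operators have equal norms
-- (`IsAdjointPair.norm_convOp_eq`). As `f ↦ f̌` reverses products, it extends to the isometric
-- anti-isomorphism of closures. The value of `‖Λ_∞(f)‖` is then the `ℓ^1` result for the opposite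
-- twist. The structure `AntiIso` treats `L.op` and the self-opposite trivial twist at once.

universe w'

/-! ## Norms in `ℓ^p` -/

namespace lp

section

variable {ι : Type*} {E : ι → Type*} [∀ i, NormedAddCommGroup (E i)] {p : ℝ≥0∞}

theorem ofReal_norm_rpow (i : ι) (x : E i) (hp : 0 < p.toReal) :
    ENNReal.ofReal (‖x‖ ^ p.toReal) = ‖x‖ₑ ^ p.toReal := by
  rw [← ENNReal.ofReal_rpow_of_nonneg (norm_nonneg _) hp.le, ofReal_norm]

theorem memℓp_iff_tsum_enorm (hp : 0 < p.toReal) {f : ∀ i, E i} :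
    Memℓp f p ↔ ∑' i, ‖f i‖ₑ ^ p.toReal ≠ ∞ := by
  rw [memℓp_gen_iff hp]
  constructor
  · intro h
    simp_rw [← ofReal_norm_rpow _ _ hp]
    exact h.tsum_ofReal_ne_top
  · intro h
    refine (ENNReal.summable_toReal h).congr fun i => ?_
    rw [← ENNReal.toReal_rpow, toReal_enorm]

/-- Passing to sums in `ℝ≥0∞` lets the Schur test interchange sums with no summability to check. -/
theorem enorm_rpow_eq_tsum (hp : 0 < p.toReal) (f : lp E p) :
    ENNReal.ofReal ‖f‖ ^ p.toReal = ∑' i, ‖f i‖ₑ ^ p.toReal := by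
  rw [ENNReal.ofReal_rpow_of_nonneg (lp.norm_nonneg' f) hp.le, lp.norm_rpow_eq_tsum hp,
    ENNReal.ofReal_tsum_of_nonneg (fun i => by positivity) ((lp.memℓp f).summable hp)]
  simp_rw [ofReal_norm_rpow _ _ hp]

/-- A section is in `ℓ^p` with norm at most `C * ‖g‖` if this holds in terms of extended
nonnegative reals. -/
theorem exists_norm_le_of_tsum_enorm_le {E' : ι → Type*} [∀ i, NormedAddCommGroup (E' i)]
    (hp : 0 < p.toReal) {f : ∀ i, E' i} {C : ℝ} (hC : 0 ≤ C) (g : lp E p)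
    (h : ∑' i, ‖f i‖ₑ ^ p.toReal ≤ ENNReal.ofReal C ^ p.toReal * ∑' i, ‖g i‖ₑ ^ p.toReal) :
    ∃ hf : Memℓp f p, ‖(⟨f, hf⟩ : lp E' p)‖ ≤ C * ‖g‖ := by
  rw [← enorm_rpow_eq_tsum hp, ← ENNReal.mul_rpow_of_nonneg _ _ hp.le,
    ← ENNReal.ofReal_mul hC] at h
  have hf : Memℓp f p := (memℓp_iff_tsum_enorm hp).2
    (h.trans_lt (ENNReal.rpow_lt_top_of_nonneg hp.le ENNReal.ofReal_ne_top)).ne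
  refine ⟨hf, ?_⟩
  have h2 := enorm_rpow_eq_tsum hp (⟨f, hf⟩ : lp E' p)
  rw [← h2, ENNReal.rpow_le_rpow_iff hp] at h
  exact (ENNReal.ofReal_le_ofReal_iff (mul_nonneg hC (lp.norm_nonneg' g))).1 h

end

/-! ### Detecting the norm of `ℓ^q` by finitely supported vectors of `ℓ^p` -/

section Dual

variable {ι : Type*} {𝕜 : Type*} [RCLike 𝕜] {E F : ι → Type*} [∀ i, NormedAddCommGroup (E i)]
  [∀ i, NormedSpace 𝕜 (E i)] [∀ i, NormedAddCommGroup (F i)] [∀ i, NormedSpace 𝕜 (F i)]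

/-- The norm of an element of `ℓ^q` is detected by finitely supported elements of `ℓ^p`. -/
theorem norm_le_of_forall_pairing_le [DecidableEq ι] {p q : ℝ≥0∞} [Fact (1 ≤ p)] [Fact (1 ≤ q)]
    (hpq : p⁻¹ + q⁻¹ = 1) (B : ∀ i, F i →ₗ[𝕜] E i →ₗ[𝕜] 𝕜)
    (hB : ∀ i (y : F i), ∃ e : E i, ‖e‖ = 1 ∧ B i y e = (‖y‖ : 𝕜)) (y : lp F q) {C : ℝ}
    (hC : 0 ≤ C)
    (h : ∀ (s : Finset ι) (e : ∀ i, E i),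
      ‖∑ i ∈ s, B i (y i) (e i)‖ ≤ C * ‖∑ i ∈ s, (lp.single p i (e i) : lp E p)‖) :
    ‖y‖ ≤ C := by
  have hp1 : 1 ≤ p := Fact.out
  have hq1 : 1 ≤ q := Fact.out
  have hp0 : 0 < p := zero_lt_one.trans_le hp1
  choose e he hBe using fun i => hB i (y i)
  -- For `q = ∞` a single coordinate at a time is enough.
  rcases eq_or_ne q ∞ with rfl | hqt
  · refine lp.norm_le_of_forall_le hC fun i => ?_
    have := h {i} e
    simpa [hBe, lp.norm_single hp0, he] using this
  have hq : 0 < q.toReal := ENNReal.toReal_pos (zero_lt_one.trans_le hq1).ne' hqt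
  refine lp.norm_le_of_forall_sum_le hq hC fun s => ?_
  set S := ∑ i ∈ s, ‖y i‖ ^ q.toReal with hS
  have hS0 : 0 ≤ S := Finset.sum_nonneg fun i _ => by positivity
  rcases hS0.eq_or_lt with hS00 | hSpos
  · rw [← hS00]; positivity
  -- The extremal vector of Hölder's inequality: with coefficients `‖y i‖ ^ (q - 1)` the pairing
  -- equals `S`, and for finite `p` the `p`-th power of its norm is also `S`, because `(q - 1) p =
  -- q`.
  have key := h s fun i => ((‖y i‖ ^ (q.toReal - 1) : ℝ) : 𝕜) • e i
  have hn : ∀ i, ‖((‖y i‖ ^ (q.toReal - 1) : ℝ) : 𝕜) • e i‖ = ‖y i‖ ^ (q.toReal - 1) := fun i => by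
    rw [norm_smul, he, mul_one, RCLike.norm_ofReal, abs_of_nonneg (by positivity)]
  have hq1' : 1 ≤ q.toReal := by
    rw [← ENNReal.toReal_one]; exact (ENNReal.toReal_le_toReal ENNReal.one_ne_top hqt).2 hq1
  have hl : ∑ i ∈ s, B i (y i) (((‖y i‖ ^ (q.toReal - 1) : ℝ) : 𝕜) • e i) = (S : 𝕜) := by
    rw [hS, RCLike.ofReal_sum]
    refine Finset.sum_congr rfl fun i _ => ?_
    rw [map_smul, hBe, smul_eq_mul, ← RCLike.ofReal_mul]
    congr 1
    rcases (norm_nonneg (y i)).eq_or_lt with h0 | h0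
    · rw [← h0, mul_zero, Real.zero_rpow hq.ne']
    · rw [← Real.rpow_add_one h0.ne', sub_add_cancel]
  rw [hl, RCLike.norm_ofReal, abs_of_nonneg hS0] at key
  -- For `p = ∞` one has `q = 1`, so all coefficients are `‖y i‖ ^ 0 = 1` (also where `y i = 0`) and
  -- the test vector has norm at most `1`.
  rcases eq_or_ne p ∞ with rfl | hpt
  · have hq' : q = 1 := by simpa using hpq
    have hq'' : q.toReal = 1 := by simp [hq']
    have : ‖∑ i ∈ s, (lp.single ∞ i (((‖y i‖ ^ (q.toReal - 1) : ℝ) : 𝕜) • e i) : lp E ∞)‖ ≤ 1 := by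
      refine lp.norm_le_of_forall_le zero_le_one fun j => ?_
      rw [lp.coeFn_sum, Finset.sum_apply]
      simp only [lp.coeFn_single]
      rw [Finset.sum_pi_single]
      split_ifs
      · rw [hn, hq'', sub_self, Real.rpow_zero]
      · simp
    have h1 : S ≤ C := key.trans (mul_le_of_le_one_right hC this)
    rwa [hq'', Real.rpow_one]
  have hp : 0 < p.toReal := ENNReal.toReal_pos hp0.ne' hpt
  have hpq' : p.toReal⁻¹ + q.toReal⁻¹ = 1 := by
    have := congrArg ENNReal.toReal hpq
    rwa [ENNReal.toReal_add (by simpa using hp0.ne') (by simpa using (zero_lt_one.trans_le hq1).ne'),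
      ENNReal.toReal_inv, ENNReal.toReal_inv, ENNReal.toReal_one] at this
  have hexp : (q.toReal - 1) * p.toReal = q.toReal := by
    field_simp at hpq'
    linarith
  have hnorm := lp.norm_sum_single hp (fun i => ((‖y i‖ ^ (q.toReal - 1) : ℝ) : 𝕜) • e i) s
  have h2 : ∑ i ∈ s, ‖((‖y i‖ ^ (q.toReal - 1) : ℝ) : 𝕜) • e i‖ ^ p.toReal = S := by
    refine Finset.sum_congr rfl fun i _ => ?_
    rw [hn, ← Real.rpow_mul (norm_nonneg _), hexp]
  rw [h2] at hnorm
  have h3 := Real.rpow_le_rpow hS0 key hp.le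
  rw [Real.mul_rpow hC (norm_nonneg _), hnorm] at h3
  -- Division of `S ^ p ≤ C ^ p * S` by `S > 0`; raising to the power `q / p` then gives `S ≤ C ^
  -- q`, since `(p - 1) q / p = 1`.
  have h4 : S ^ (p.toReal - 1) ≤ C ^ p.toReal := by
    rw [Real.rpow_sub_one hSpos.ne', div_le_iff₀ hSpos]
    exact h3
  have h5 := Real.rpow_le_rpow (by positivity) h4 (show 0 ≤ q.toReal / p.toReal by positivity)
  rw [← Real.rpow_mul hS0, ← Real.rpow_mul hC] at h5
  have h6 : (p.toReal - 1) * (q.toReal / p.toReal) = 1 := by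
    field_simp at hpq' ⊢
    linarith
  have h7 : p.toReal * (q.toReal / p.toReal) = q.toReal := by field_simp
  rwa [h6, h7, Real.rpow_one] at h5

end Dual

end lp

/-! ## Norm estimates for convolution operators -/

/-- The substitution `(γ, η) ↦ (η⁻¹γ, η)` is injective, since `γ = η(η⁻¹γ)`. This is the exchange of
summations in the Schur test. -/
theorem Arr.tsum_tsum_ldiv_le {X : Type u} [Groupoid.{v} X]
    (F : Quiver.Total X → Quiver.Total X → ℝ≥0∞) :
    ∑' γ : Quiver.Total X, ∑' η : {η : Quiver.Total X // η.right = γ.right},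
        F η.1 (Arr.ldiv η.1 γ η.2) ≤
      ∑' β : Quiver.Total X, ∑' η : {η : Quiver.Total X // η.left = β.right}, F η.1 β := by
  rw [← ENNReal.tsum_sigma, ← ENNReal.tsum_sigma]
  let φ : (Σ γ : Quiver.Total X, {η : Quiver.Total X // η.right = γ.right}) →
      Σ β : Quiver.Total X, {η : Quiver.Total X // η.left = β.right} :=
    fun z => ⟨Arr.ldiv z.2.1 z.1 z.2.2, z.2.1, (Arr.isComp_ldiv _ _ z.2.2).1⟩
  have hφ : Function.Injective φ := by
    rintro ⟨γ, η, h⟩ ⟨γ', η', h'⟩ he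
    have h1 := congrArg Sigma.fst he
    have h2 := congrArg (fun z => z.2.1) he
    dsimp only [φ] at h1 h2
    subst h2
    have h3 := Arr.isComp_ldiv η γ h
    rw [h1] at h3
    obtain rfl := h3.unique (Arr.isComp_ldiv η γ' h')
    rfl
  exact ENNReal.tsum_comp_le_tsum_of_injective hφ fun z => F z.2.1 z.1

namespace Twist

variable {𝕜 : Type} [RCLike 𝕜] {X : Type u} [TopologicalSpace X] [Groupoid.{v} X]
  [TopologicalSpace (Quiver.Total X)] {L : Twist.{u, v, w} 𝕜 X}

theorem tsum_le_normD (f : L.Section) (x : X) :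
    ∑' γ : {γ : Quiver.Total X // γ.left = x}, ‖f γ.1‖ₑ ≤ L.normD f :=
  le_iSup (fun x => ∑' γ : {γ : Quiver.Total X // γ.left = x}, ‖f γ.1‖ₑ) x

theorem tsum_le_normR (f : L.Section) (x : X) :
    ∑' γ : {γ : Quiver.Total X // γ.right = x}, ‖f γ.1‖ₑ ≤ L.normR f :=
  le_iSup (fun x => ∑' γ : {γ : Quiver.Total X // γ.right = x}, ‖f γ.1‖ₑ) x

theorem enorm_mul {α β γ : Quiver.Total X} (h : Arr.IsComp α β γ) (a : L.fiber α)
    (b : L.fiber β) : ‖L.mul h a b‖ₑ = ‖a‖ₑ * ‖b‖ₑ := by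
  rw [← ofReal_norm, L.norm_mul, ENNReal.ofReal_mul (norm_nonneg _), ofReal_norm, ofReal_norm]

/-- Hölder's inequality for the sum that defines a convolution product. -/
theorem enorm_conv_rpow_le {f : L.Section} (hf : f ∈ L.Cc) (ξ : L.Section) {t : ℝ} (ht : 1 ≤ t)
    (γ : Quiver.Total X) :
    ‖L.conv f ξ γ‖ₑ ^ t ≤ L.normR f ^ (t - 1) *
      ∑' η : {η : Quiver.Total X // η.right = γ.right},
        ‖f η.1‖ₑ * ‖ξ (Arr.ldiv η.1 γ η.2)‖ₑ ^ t := by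
  have ht0 : 0 < t := by linarith
  unfold conv
  rw [finsum_eq_sum _ (finite_conv_support hf ξ γ)]
  set s := (finite_conv_support hf ξ γ).toFinset
  have h1 := (enorm_sum_le s fun η : {η : Quiver.Total X // η.right = γ.right} =>
    L.mul (Arr.isComp_ldiv η.1 γ η.2) (f η.1) (ξ (Arr.ldiv η.1 γ η.2)))
  simp only [enorm_mul] at h1
  -- Hölder with weights `w = |f(η)|`: `∑ w x ≤ (∑ w)^{1 - 1/t} (∑ w x^t)^{1/t}`. The weights sum to
  -- at most `‖f‖_{r*}`, as all `η` have the range of `γ`.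
  have h2 := h1.trans (ENNReal.inner_le_weight_mul_Lp_of_nonneg s ht _ _)
  refine (ENNReal.rpow_le_rpow h2 ht0.le).trans ?_
  rw [ENNReal.mul_rpow_of_nonneg _ _ ht0.le, ← ENNReal.rpow_mul, ← ENNReal.rpow_mul,
    inv_mul_cancel₀ ht0.ne', ENNReal.rpow_one, sub_mul, inv_mul_cancel₀ ht0.ne', one_mul]
  refine mul_le_mul' (ENNReal.rpow_le_rpow ?_ (by linarith)) (ENNReal.sum_le_tsum s)
  exact (ENNReal.sum_le_tsum (f := fun η : {η : Quiver.Total X // η.right = γ.right} => ‖f η.1‖ₑ)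
    s).trans (tsum_le_normR f γ.right)

/-- The Schur test for convolution operators. -/
theorem tsum_enorm_conv_rpow_le {f : L.Section} (hf : f ∈ L.Cc) (ξ : L.Section) {t : ℝ}
    (ht : 1 ≤ t) :
    ∑' γ, ‖L.conv f ξ γ‖ₑ ^ t ≤ L.normR f ^ (t - 1) * L.normD f * ∑' γ, ‖ξ γ‖ₑ ^ t := by
  refine (ENNReal.tsum_le_tsum fun γ => enorm_conv_rpow_le hf ξ ht γ).trans ?_
  rw [ENNReal.tsum_mul_left, _root_.mul_assoc]
  refine mul_le_mul_right ?_ _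
  -- After regrouping, `β` is fixed and `η` runs over the arrows with domain `r(β)`, so the weights
  -- now sum to at most `‖f‖_{d*}`.
  refine (Arr.tsum_tsum_ldiv_le fun α β => ‖f α‖ₑ * ‖ξ β‖ₑ ^ t).trans ?_
  rw [← ENNReal.tsum_mul_left]
  refine ENNReal.tsum_le_tsum fun β => ?_
  rw [ENNReal.tsum_mul_right]
  exact mul_le_mul_left (tsum_le_normD f β.right) _

/-- The case `t = 1` of the pointwise Hölder estimate, where the factor `‖f‖_{r*}^{t-1}` is `1`; it
replaces the Schur test at `p = ∞`. -/
theorem enorm_conv_le_normR_mul {f : L.Section} (hf : f ∈ L.Cc) (ξ : L.Section) {C : ℝ≥0∞}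
    (hξ : ∀ γ, ‖ξ γ‖ₑ ≤ C) (γ : Quiver.Total X) : ‖L.conv f ξ γ‖ₑ ≤ L.normR f * C := by
  have h := enorm_conv_rpow_le hf ξ le_rfl γ
  simp only [ENNReal.rpow_one, sub_self, ENNReal.rpow_zero, one_mul] at h
  refine h.trans ?_
  refine (ENNReal.tsum_le_tsum fun η => mul_le_mul_right (hξ _) _).trans ?_
  rw [ENNReal.tsum_mul_right]
  exact mul_le_mul_left (tsum_le_normR f γ.right) _

/-- A section over a bisection has at most one nonzero value on each fiber of `e`, so it contributes
at most its sup norm. The map `e` stands for `d` or `r`. -/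
theorem tsum_fiber_le_maxNorm {f : L.Section} (hf : f ∈ L.Cc) (e : Quiver.Total X → X)
    (he : ∀ U : Set (Quiver.Total X), IsBisection U → Set.InjOn e U) (x : X) :
    ∑' γ : {γ : Quiver.Total X // e γ = x}, ‖f γ.1‖ₑ ≤ ENNReal.ofReal (L.maxNorm f) := by
  refine le_of_forall_gt_imp_ge_of_dense fun t ht => ?_
  rcases eq_or_ne t ∞ with rfl | htt
  · exact le_top
  obtain ⟨n, U, g, hg, rfl, hlt⟩ := exists_lt_of_maxNorm_lt hf
    ((ENNReal.ofReal_lt_iff_lt_toReal (maxNorm_nonneg f) htt).1 ht)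
  have hk : ∀ k, ∑' γ : {γ : Quiver.Total X // e γ = x}, ‖g k γ.1‖ₑ ≤
      ENNReal.ofReal (⨆ γ, ‖g k γ‖) := by
    intro k
    by_cases h : ∃ γ : {γ : Quiver.Total X // e γ = x}, g k γ.1 ≠ 0
    · obtain ⟨γ, hγ⟩ := h
      rw [tsum_eq_single γ]
      · rw [← ofReal_norm]
        exact ENNReal.ofReal_le_ofReal (le_ciSup (hg k).2.bddAbove γ.1)
      · intro γ' hγ'
        by_contra h0
        have h1 : g k γ'.1 ≠ 0 := fun h => h0 (by simp [h])
        exact hγ' (Subtype.ext (he _ (hg k).1 ((hg k).2.mem_of_ne h1) ((hg k).2.mem_of_ne hγ)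
          (γ'.2.trans γ.2.symm)))
    · push Not at h
      simp [h]
  calc ∑' γ : {γ : Quiver.Total X // e γ = x}, ‖(∑ k, g k) γ.1‖ₑ
      ≤ ∑' γ : {γ : Quiver.Total X // e γ = x}, ∑ k, ‖g k γ.1‖ₑ := by
        refine ENNReal.tsum_le_tsum fun γ => ?_
        rw [Finset.sum_apply]
        exact enorm_sum_le _ _
    _ = ∑ k, ∑' γ : {γ : Quiver.Total X // e γ = x}, ‖g k γ.1‖ₑ :=
        Summable.tsum_finsetSum fun _ _ => ENNReal.summable
    _ ≤ ∑ k, ENNReal.ofReal (⨆ γ, ‖g k γ‖) := Finset.sum_le_sum fun k _ => hk k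
    _ = ENNReal.ofReal (∑ k, ⨆ γ, ‖g k γ‖) :=
        (ENNReal.ofReal_sum_of_nonneg fun k _ => Real.iSup_nonneg fun _ => norm_nonneg _).symm
    _ ≤ t := ENNReal.ofReal_le_of_le_toReal hlt.le

theorem normI_le_maxNorm {f : L.Section} (hf : f ∈ L.Cc) :
    L.normI f ≤ ENNReal.ofReal (L.maxNorm f) :=
  max_le (iSup_le fun x => tsum_fiber_le_maxNorm hf _ (fun _ hU => hU.injOn_left) x)
    (iSup_le fun x => tsum_fiber_le_maxNorm hf _ (fun _ hU => hU.injOn_right) x)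

/-! ### The Schur bound and its consequences on `ℓ^p` -/

/-- The bound `‖f‖_{d*}^{1/p} ‖f‖_{r*}^{1/q}` for the norm of a convolution operator. -/
noncomputable def schurBound (L : Twist.{u, v, w} 𝕜 X) (p q : ℝ≥0∞) (f : L.Section) : ℝ≥0∞ :=
  L.normD f ^ p⁻¹.toReal * L.normR f ^ q⁻¹.toReal

theorem toReal_inv_add_toReal_inv {p q : ℝ≥0∞} (hpq : p⁻¹ + q⁻¹ = 1) :
    p⁻¹.toReal + q⁻¹.toReal = 1 := by
  have h1 : p⁻¹ ≠ ∞ := ne_top_of_le_ne_top ENNReal.one_ne_top (hpq ▸ le_self_add)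
  have h2 : q⁻¹ ≠ ∞ := ne_top_of_le_ne_top ENNReal.one_ne_top (hpq ▸ le_add_self)
  rw [← ENNReal.toReal_add h1 h2, hpq, ENNReal.toReal_one]

theorem schurBound_le_normI {p q : ℝ≥0∞} (hpq : p⁻¹ + q⁻¹ = 1) (f : L.Section) :
    L.schurBound p q f ≤ L.normI f := by
  calc L.schurBound p q f
      ≤ L.normI f ^ p⁻¹.toReal * L.normI f ^ q⁻¹.toReal :=
        mul_le_mul' (ENNReal.rpow_le_rpow (le_max_left _ _) ENNReal.toReal_nonneg)
          (ENNReal.rpow_le_rpow (le_max_right _ _) ENNReal.toReal_nonneg)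
    _ = L.normI f := by
        rw [← ENNReal.rpow_add_of_nonneg _ _ ENNReal.toReal_nonneg ENNReal.toReal_nonneg,
          toReal_inv_add_toReal_inv hpq, ENNReal.rpow_one]

theorem schurBound_le_maxNorm {p q : ℝ≥0∞} (hpq : p⁻¹ + q⁻¹ = 1) {f : L.Section}
    (hf : f ∈ L.Cc) : L.schurBound p q f ≤ ENNReal.ofReal (L.maxNorm f) :=
  (schurBound_le_normI hpq f).trans (normI_le_maxNorm hf)

theorem schurBound_ne_top {p q : ℝ≥0∞} (hpq : p⁻¹ + q⁻¹ = 1) {f : L.Section}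
    (hf : f ∈ L.Cc) : L.schurBound p q f ≠ ∞ :=
  ne_top_of_le_ne_top ENNReal.ofReal_ne_top (schurBound_le_maxNorm hpq hf)

/-- Convolution by an element of `𝔠_c(G, L)` maps `ℓ^p(G, L)` to itself. -/
theorem exists_norm_conv_le {p q : ℝ≥0∞} [Fact (1 ≤ p)] (hpq : p⁻¹ + q⁻¹ = 1)
    {f : L.Section} (hf : f ∈ L.Cc) (ξ : L.ellP p) :
    ∃ h : Memℓp (L.conv f ξ) p,
      ‖(⟨L.conv f ξ, h⟩ : L.ellP p)‖ ≤ (L.schurBound p q f).toReal * ‖ξ‖ := by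
  have hp1 : 1 ≤ p := Fact.out
  have htop := schurBound_ne_top hpq hf
  rcases eq_or_ne p ∞ with rfl | hpt
  -- At `p = ∞` the exponent of `‖f‖_{d*}` is `0`, so the bound is just `‖f‖_{r*}`.
  · have hq : q = 1 := by simpa using hpq
    subst hq
    have hB : L.schurBound ∞ 1 f = L.normR f := by simp [schurBound]
    have hle : ∀ γ, ‖L.conv f ξ γ‖ ≤ (L.schurBound ∞ 1 f).toReal * ‖ξ‖ := by
      intro γ
      have := enorm_conv_le_normR_mul hf ξ (C := ENNReal.ofReal ‖ξ‖) (fun γ => by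
        rw [← ofReal_norm]
        exact ENNReal.ofReal_le_ofReal (lp.norm_apply_le_norm ENNReal.top_ne_zero ξ γ)) γ
      rw [← hB, ← ENNReal.ofReal_toReal htop, ← ENNReal.ofReal_mul ENNReal.toReal_nonneg,
        ← ofReal_norm] at this
      exact (ENNReal.ofReal_le_ofReal_iff (by positivity)).1 this
    refine ⟨memℓp_infty ⟨_, Set.forall_mem_range.2 hle⟩, ?_⟩
    exact lp.norm_le_of_forall_le (by positivity) hle
  have hp : 0 < p.toReal := ENNReal.toReal_pos (zero_lt_one.trans_le hp1).ne' hpt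
  have hp1' : 1 ≤ p.toReal := by
    rw [← ENNReal.toReal_one]; exact (ENNReal.toReal_le_toReal ENNReal.one_ne_top hpt).2 hp1
  refine lp.exists_norm_le_of_tsum_enorm_le hp ENNReal.toReal_nonneg ξ ?_
  refine (tsum_enorm_conv_rpow_le hf ξ hp1').trans (mul_le_mul_left (le_of_eq ?_) _)
  -- The `p`-th power of the bound is `‖f‖_{d*} ‖f‖_{r*}^{p-1}`, because `p / q = p - 1`; this is
  -- the constant of the Schur test with `t = p`.
  rw [ENNReal.ofReal_toReal htop, schurBound, ENNReal.mul_rpow_of_nonneg _ _ hp.le,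
    ← ENNReal.rpow_mul, ← ENNReal.rpow_mul]
  have h1 : p⁻¹.toReal * p.toReal = 1 := by
    rw [ENNReal.toReal_inv, inv_mul_cancel₀ hp.ne']
  have h2 : q⁻¹.toReal * p.toReal = p.toReal - 1 := by
    have := congrArg (· * p.toReal) (toReal_inv_add_toReal_inv hpq)
    simp only [add_mul, h1, one_mul] at this
    linarith
  rw [h1, h2, ENNReal.rpow_one, mul_comm]

end Twist

/-! ## The regular representation -/

namespace Arr

variable {X : Type u} [Groupoid.{v} X]

theorem IsComp.unique_left {α α' β γ : Quiver.Total X} (h : IsComp α β γ)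
    (h' : IsComp α' β γ) : α = α' :=
  inv_injective (h.inv.unique_right h'.inv)

theorem isComp_unit_right (γ : Quiver.Total X) : IsComp γ (unit γ.left) γ :=
  isComp_iff.2 ⟨_, _, _, 𝟙 _, γ.hom, rfl, rfl, by simp⟩

theorem isComp_inv_left {α β γ : Quiver.Total X} (h : IsComp α β γ) :
    IsComp (inv α) γ β := by
  obtain ⟨x, y, z, g, f, rfl, rfl, rfl⟩ := isComp_iff.1 h
  exact isComp_iff.2 ⟨_, _, _, _, _, rfl, rfl, by simp⟩

end Arr

namespace Twist

variable {𝕜 : Type} [RCLike 𝕜] {X : Type u} [TopologicalSpace X] [Groupoid.{v} X]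
  [TopologicalSpace (Quiver.Total X)] {L : Twist.{u, v, w} 𝕜 X}

/-- If `g` lives on the single arrow `β`, then only `η = α` satisfies `η⁻¹γ = β`. Used with point
masses for `g`, and with no condition on `f`. -/
theorem conv_eq_of_unique_right {f g : L.Section} {α β γ : Quiver.Total X}
    (h : Arr.IsComp α β γ) (hg : ∀ β', g β' ≠ 0 → β' = β) :
    L.conv f g γ = L.mul h (f α) (g β) := by
  have hr := h.right_eq
  have hb : β = Arr.ldiv α γ hr.symm := h.unique_right (Arr.isComp_ldiv _ _ _)
  subst hb
  unfold conv
  rw [finsum_eq_single _ (⟨α, hr.symm⟩ : {η : Quiver.Total X // η.right = γ.right})]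
  intro η hη
  by_cases h0 : g (Arr.ldiv η.1 γ η.2) = 0
  · rw [h0, map_zero]
  · have h1 := Arr.isComp_ldiv η.1 γ η.2
    rw [hg _ h0] at h1
    exact absurd (Subtype.ext (h1.unique_left h)) hη

/-- Makes `ℓ^p(G, L)`, and hence its operator algebra, complete, as the extension by density
requires. -/
instance completeSpace_fiber (L : Twist.{u, v, w} 𝕜 X) (γ : Quiver.Total X) :
    CompleteSpace (L.fiber γ) :=
  have : FiniteDimensional 𝕜 (L.fiber γ) :=
    Module.finite_of_finrank_pos (by rw [L.finrank_fiber]; exact one_pos)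
  FiniteDimensional.complete 𝕜 _

theorem exists_norm_eq_one (L : Twist.{u, v, w} 𝕜 X) (γ : Quiver.Total X) :
    ∃ e : L.fiber γ, ‖e‖ = 1 := by
  have : Nontrivial (L.fiber γ) :=
    Module.nontrivial_of_finrank_pos (R := 𝕜) (by rw [L.finrank_fiber]; exact one_pos)
  obtain ⟨z, hz⟩ := exists_ne (0 : L.fiber γ)
  exact ⟨((‖z‖⁻¹ : ℝ) : 𝕜) • z, by
    rw [norm_smul, RCLike.norm_ofReal, abs_of_nonneg (inv_nonneg.2 (norm_nonneg z)),
      inv_mul_cancel₀ (norm_ne_zero_iff.2 hz)]⟩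

/-- Convolution by an element of `𝔠_c(G, L)` as an operator on `ℓ^p(G, L)`. -/
noncomputable def convOp {p q : ℝ≥0∞} [Fact (1 ≤ p)] (hpq : p⁻¹ + q⁻¹ = 1) (f : L.CcAlg) :
    L.ellP p →L[𝕜] L.ellP p :=
  LinearMap.mkContinuous
    { toFun := fun ξ => ⟨L.conv f.val ξ, (exists_norm_conv_le hpq f.mem ξ).1⟩
      map_add' := fun _ _ => lp.ext (conv_add_right f.mem _ _)
      map_smul' := fun c _ => lp.ext (conv_smul_right c f.val _) }
    (L.schurBound p q f.val).toReal fun ξ => (exists_norm_conv_le hpq f.mem ξ).2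

theorem convOp_apply {p q : ℝ≥0∞} [Fact (1 ≤ p)] (hpq : p⁻¹ + q⁻¹ = 1) (f : L.CcAlg)
    (ξ : L.ellP p) : (convOp hpq f ξ : ∀ γ, L.fiber γ) = L.conv f.val ξ := rfl

theorem norm_convOp_le {p q : ℝ≥0∞} [Fact (1 ≤ p)] (hpq : p⁻¹ + q⁻¹ = 1) (f : L.CcAlg) :
    ‖convOp hpq f‖ ≤ (L.schurBound p q f.val).toReal :=
  LinearMap.mkContinuous_norm_le _ ENNReal.toReal_nonneg _

/-! ### Extension to `F(G, L)`, uniqueness, injectivity and the `ℓ^1` norm -/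

section Rep

variable [IsEtaleGroupoid X] [T2Space X]

theorem norm_convOp_le_norm {p q : ℝ≥0∞} [Fact (1 ≤ p)] (hpq : p⁻¹ + q⁻¹ = 1) (f : L.CcAlg) :
    ‖convOp hpq f‖ ≤ ‖f‖ :=
  (norm_convOp_le hpq f).trans
    (ENNReal.toReal_le_of_le_ofReal (norm_nonneg f) (schurBound_le_maxNorm hpq f.mem))

/-- Convolution operators as a linear map. -/
noncomputable def convOpₗ (L : Twist.{u, v, w} 𝕜 X) {p q : ℝ≥0∞} [Fact (1 ≤ p)]
    (hpq : p⁻¹ + q⁻¹ = 1) : L.CcAlg →ₗ[𝕜] (L.ellP p →L[𝕜] L.ellP p) where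
  toFun := convOp hpq
  map_add' f g := ContinuousLinearMap.ext fun _ => lp.ext (conv_add_left f.mem g.mem _)
  map_smul' c f := ContinuousLinearMap.ext fun _ => lp.ext (conv_smul_left c f.val _)

theorem convOp_mul {p q : ℝ≥0∞} [Fact (1 ≤ p)] (hpq : p⁻¹ + q⁻¹ = 1) (f g : L.CcAlg) :
    convOp hpq (f * g) = convOp hpq f * convOp hpq g :=
  ContinuousLinearMap.ext fun _ => lp.ext (conv_assoc f.mem g.mem _)

/-- The linear map underlying the regular representation. -/
noncomputable def regularRepCLM (L : Twist.{u, v, w} 𝕜 X) {p q : ℝ≥0∞} [Fact (1 ≤ p)]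
    (hpq : p⁻¹ + q⁻¹ = 1) : L.BanachAlg →L[𝕜] (L.ellP p →L[𝕜] L.ellP p) :=
  (L.convOpₗ hpq).extendOfNorm
    (UniformSpace.Completion.toComplL : L.CcAlg →L[𝕜] L.BanachAlg).toLinearMap

theorem denseRange_toComplL (L : Twist.{u, v, w} 𝕜 X) :
    DenseRange (UniformSpace.Completion.toComplL : L.CcAlg →L[𝕜] L.BanachAlg).toLinearMap :=
  UniformSpace.Completion.denseRange_coe

/-- Density together with contractivity for `‖·‖_max` (constant `1`) makes the extension agree with
convolution. -/
theorem regularRepCLM_coe {p q : ℝ≥0∞} [Fact (1 ≤ p)] (hpq : p⁻¹ + q⁻¹ = 1) (f : L.CcAlg) :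
    L.regularRepCLM hpq (f : UniformSpace.Completion L.CcAlg) = convOp hpq f :=
  LinearMap.extendOfNorm_eq L.denseRange_toComplL
    ⟨1, fun f => by simpa using! norm_convOp_le_norm hpq f⟩ f

/-- The regular representation of `F(G, L)` on `ℓ^p(G, L)`. -/
noncomputable def regularRep (L : Twist.{u, v, w} 𝕜 X) {p q : ℝ≥0∞} [Fact (1 ≤ p)]
    (hpq : p⁻¹ + q⁻¹ = 1) : L.BanachAlg →ₙₐ[𝕜] (L.ellP p →L[𝕜] L.ellP p) where
  toFun := L.regularRepCLM hpq
  map_smul' c a := map_smul (L.regularRepCLM hpq) c a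
  map_zero' := map_zero _
  map_add' := map_add _
  map_mul' a b := by
    refine UniformSpace.Completion.induction_on₂ a b
      (isClosed_eq (by fun_prop) (by fun_prop)) fun f g => ?_
    rw [← NonUnitalCompletion.coe_mul, regularRepCLM_coe, regularRepCLM_coe, regularRepCLM_coe,
      convOp_mul]

theorem isRegularRep_regularRep (L : Twist.{u, v, w} 𝕜 X) {p q : ℝ≥0∞} [Fact (1 ≤ p)]
    (hpq : p⁻¹ + q⁻¹ = 1) : IsRegularRep (L.regularRep hpq) where
  norm_le a := by
    have := LinearMap.norm_extendOfNorm_apply_le (f := L.convOpₗ hpq) L.denseRange_toComplL 1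
      (fun f => by simpa using! norm_convOp_le_norm hpq f) a
    rwa [one_mul] at this
  apply_eq f ξ := by
    change (L.regularRepCLM hpq (f : UniformSpace.Completion L.CcAlg) ξ : ∀ γ, L.fiber γ) = _
    rw [regularRepCLM_coe, convOp_apply]

namespace IsRegularRep

variable {p : ℝ≥0∞} [Fact (1 ≤ p)] {Λ : L.BanachAlg →ₙₐ[𝕜] (L.ellP p →L[𝕜] L.ellP p)}

theorem continuous (hΛ : IsRegularRep Λ) : Continuous Λ :=
  AddMonoidHomClass.continuous_of_bound Λ 1 fun a => by simpa using hΛ.norm_le a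

/-- Two contractive maps that agree on the dense image of `𝔠_c(G, L)` are equal. -/
theorem unique (hΛ : IsRegularRep Λ) {Λ' : L.BanachAlg →ₙₐ[𝕜] (L.ellP p →L[𝕜] L.ellP p)}
    (hΛ' : IsRegularRep Λ') : Λ = Λ' := by
  refine NonUnitalAlgHom.ext fun a => ?_
  refine UniformSpace.Completion.induction_on a (isClosed_eq hΛ.continuous hΛ'.continuous)
    fun f => ContinuousLinearMap.ext fun ξ => lp.ext ?_
  exact (hΛ.apply_eq f ξ).trans (hΛ'.apply_eq f ξ).symm

theorem eq_convOp (hΛ : IsRegularRep Λ) {q : ℝ≥0∞} (hpq : p⁻¹ + q⁻¹ = 1) (f : L.CcAlg) :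
    Λ (L.toBanachAlg f) = convOp hpq f :=
  ContinuousLinearMap.ext fun ξ => lp.ext (hΛ.apply_eq f ξ)

theorem enorm_le (hΛ : IsRegularRep Λ) {q : ℝ≥0∞} (hpq : p⁻¹ + q⁻¹ = 1) (f : L.CcAlg) :
    ‖Λ (L.toBanachAlg f)‖ₑ ≤ L.schurBound p q f.val := by
  rw [hΛ.eq_convOp hpq, ← ofReal_norm]
  exact ENNReal.ofReal_le_of_le_toReal (norm_convOp_le hpq f)

open Classical in
-- The only factorization of `γ` with the given unit on the right is `γ = γ · d(γ)`. A point mass at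
-- a unit therefore reads off `f` on a whole fiber of `d`.
theorem apply_single_unit (hΛ : IsRegularRep Λ) (f : L.CcAlg) (γ : Quiver.Total X)
    (e : L.fiber (Arr.unit γ.left)) :
    (Λ (L.toBanachAlg f) (lp.single p (Arr.unit γ.left) e) : ∀ γ, L.fiber γ) γ =
      L.mul (Arr.isComp_unit_right γ) (f.val γ) e := by
  rw [hΛ.apply_eq, conv_eq_of_unique_right (Arr.isComp_unit_right γ), lp.single_apply_self]
  intro β hβ
  by_contra h
  exact hβ (lp.single_apply_ne p _ e h)

theorem injective (hΛ : IsRegularRep Λ) :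
    Function.Injective fun f : L.CcAlg => Λ (L.toBanachAlg f) := by
  classical
  intro f g h
  refine CcAlg.ext (funext fun γ => ?_)
  obtain ⟨e, he⟩ := L.exists_norm_eq_one (Arr.unit γ.left)
  have h1 := hΛ.apply_single_unit f γ e
  rw [show Λ (L.toBanachAlg f) = Λ (L.toBanachAlg g) from h, hΛ.apply_single_unit g γ e] at h1
  -- Multiplication by the unit vector `e` preserves norms, so `f(γ) - g(γ)` has norm `0`.
  have h2 := L.norm_mul (Arr.isComp_unit_right γ) (f.val γ - g.val γ) e
  rw [map_sub, LinearMap.sub_apply, h1, sub_self, norm_zero, he, mul_one] at h2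
  exact sub_eq_zero.1 (norm_eq_zero.1 h2.symm)

end IsRegularRep

/-- The upper bound is the Schur bound at `p = 1`. For the lower bound, the image of a unit vector
at the unit `x` has `ℓ^1` norm at least the sum of `|f|` over `d⁻¹(x)`. -/
theorem IsRegularRep.enorm_eq_normD {Λ : L.BanachAlg →ₙₐ[𝕜] (L.ellP 1 →L[𝕜] L.ellP 1)}
    (hΛ : IsRegularRep Λ) (f : L.CcAlg) : ‖Λ (L.toBanachAlg f)‖ₑ = L.normD f.val := by
  classical
  refine le_antisymm ?_ (iSup_le fun x => ?_)
  · simpa [schurBound] using hΛ.enorm_le (q := ∞) (by simp) f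
  obtain ⟨e, he⟩ := L.exists_norm_eq_one (Arr.unit x)
  let ξ : L.ellP 1 := lp.single 1 (Arr.unit x) e
  have hξ : ‖ξ‖ = 1 := by rw [lp.norm_single one_pos, he]
  calc ∑' γ : {γ : Quiver.Total X // γ.left = x}, ‖f.val γ.1‖ₑ
      = ∑' γ : {γ : Quiver.Total X // γ.left = x},
          ‖(Λ (L.toBanachAlg f) ξ : ∀ γ, L.fiber γ) γ.1‖ₑ := by
        refine tsum_congr fun γ => ?_
        obtain ⟨γ, rfl⟩ := γ
        rw [hΛ.apply_single_unit f γ e, enorm_mul, ← ofReal_norm e, he, ENNReal.ofReal_one,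
          mul_one]
    _ ≤ ∑' γ, ‖(Λ (L.toBanachAlg f) ξ : ∀ γ, L.fiber γ) γ‖ₑ :=
        ENNReal.tsum_comp_le_tsum_of_injective Subtype.val_injective _
    _ = ENNReal.ofReal ‖Λ (L.toBanachAlg f) ξ‖ := by
        simpa using (lp.enorm_rpow_eq_tsum (p := 1) (by simp) (Λ (L.toBanachAlg f) ξ)).symm
    _ ≤ ‖Λ (L.toBanachAlg f)‖ₑ := by
        rw [← ofReal_norm]
        refine ENNReal.ofReal_le_ofReal ?_
        simpa [hξ] using (Λ (L.toBanachAlg f)).le_opNorm ξ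

end Rep

end Twist

/-! ## Duality of regular representations -/

namespace Twist

variable {𝕜 : Type} [RCLike 𝕜] {X : Type u} [TopologicalSpace X] [Groupoid.{v} X]
  [TopologicalSpace (Quiver.Total X)]

section Adjoint

variable {L : Twist.{u, v, w} 𝕜 X} {L' : Twist.{u, v, w'} 𝕜 X}

/-- Convolution by `f` and convolution by `f'` are adjoint to each other with respect to the
fiberwise pairing `B`. -/
def IsAdjointPair (B : ∀ γ, L'.fiber γ →ₗ[𝕜] L.fiber γ →ₗ[𝕜] 𝕜) (f : L.Section)
    (f' : L'.Section) : Prop :=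
  ∀ {α α' β γ : Quiver.Total X} (h : Arr.IsComp α β γ) (h' : Arr.IsComp α' γ β)
    (a : L'.fiber γ) (b : L.fiber β), B γ a (L.mul h (f α) b) = B β (L'.mul h' (f' α') a) b

/-- The relation is symmetric because `α'` enters by a composability condition of the same shape as
that of `α`. This yields the second of two opposite norm inequalities. -/
theorem IsAdjointPair.flip {B : ∀ γ, L'.fiber γ →ₗ[𝕜] L.fiber γ →ₗ[𝕜] 𝕜} {f : L.Section}
    {f' : L'.Section} (h : IsAdjointPair B f f') :
    IsAdjointPair (fun γ => (B γ).flip) f' f :=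
  fun h₁ h₂ a b => (h h₂ h₁ b a).symm

open Classical in
-- The identity `⟨ξ', f * ξ⟩ = ⟨f' * ξ', ξ⟩` for a point mass `ξ` at `β`. The section `f * ξ` lives
-- on the arrows `η⁻¹β` with `r(η) = r(β)`; indexed by `η`, the terms match those of `(f' * ξ')(β)`,
-- finitely many of which are nonzero.
theorem IsAdjointPair.hasSum {B : ∀ γ, L'.fiber γ →ₗ[𝕜] L.fiber γ →ₗ[𝕜] 𝕜} {f : L.Section}
    {f' : L'.Section} (h : IsAdjointPair B f f') (hf' : f' ∈ L'.Cc)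
    (ξ' : L'.Section) (β : Quiver.Total X) (b : L.fiber β) :
    HasSum (fun γ => B γ (ξ' γ) (L.conv f (Pi.single β b) γ)) (B β (L'.conv f' ξ' β) b) := by
  let φ : {η : Quiver.Total X // η.right = β.right} → Quiver.Total X :=
    fun η => Arr.ldiv η.1 β η.2
  have hφ : Function.Injective φ := by
    rintro ⟨η, hη⟩ ⟨η', hη'⟩ he
    have h1 := Arr.isComp_ldiv η β hη
    rw [show Arr.ldiv η β hη = Arr.ldiv η' β hη' from he] at h1
    exact Subtype.ext (h1.unique_left (Arr.isComp_ldiv η' β hη'))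
  rw [← hφ.hasSum_iff]
  · have hfin := finite_conv_support hf' ξ' β
    have hconv : L'.conv f' ξ' β = ∑ η ∈ hfin.toFinset,
        L'.mul (Arr.isComp_ldiv η.1 β η.2) (f' η.1) (ξ' (Arr.ldiv η.1 β η.2)) :=
      finsum_eq_sum _ hfin
    have hterm : ∀ η, ((fun γ => B γ (ξ' γ) (L.conv f (Pi.single β b) γ)) ∘ φ) η =
        B β (L'.mul (Arr.isComp_ldiv η.1 β η.2) (f' η.1) (ξ' (Arr.ldiv η.1 β η.2))) b := by
      intro η
      have hc := Arr.isComp_ldiv η.1 β η.2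
      have hc' := Arr.isComp_inv_left hc
      rw [← h hc' hc, Function.comp_apply, conv_eq_of_unique_right hc', Pi.single_eq_same]
      intro β' hβ'
      by_contra hne
      exact hβ' (Pi.single_eq_of_ne hne b)
    rw [hconv, map_sum, LinearMap.sum_apply, Finset.sum_congr rfl fun η _ => (hterm η).symm]
    refine hasSum_sum_of_ne_finset_zero fun η hη => ?_
    have h0 : L'.mul (Arr.isComp_ldiv η.1 β η.2) (f' η.1) (ξ' (Arr.ldiv η.1 β η.2)) = 0 := by
      simpa using hη
    rw [hterm, h0, map_zero, LinearMap.zero_apply]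
  · intro γ hγ
    rw [conv_eq_zero, map_zero]
    intro α β' hc _
    refine Pi.single_eq_of_ne (fun hne => hγ ?_) b
    subst hne
    have hc' := Arr.isComp_inv_left hc
    refine ⟨⟨Arr.inv α, hc'.right_eq.symm⟩, ?_⟩
    exact (Arr.isComp_ldiv _ _ _).unique_right hc'

theorem exists_pairing_eq_norm {B : ∀ γ, L'.fiber γ →ₗ[𝕜] L.fiber γ →ₗ[𝕜] 𝕜}
    (hB : ∀ γ a b, ‖B γ a b‖ = ‖a‖ * ‖b‖) (γ : Quiver.Total X) (y : L'.fiber γ) :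
    ∃ e : L.fiber γ, ‖e‖ = 1 ∧ B γ y e = (‖y‖ : 𝕜) := by
  obtain ⟨e, he⟩ := L.exists_norm_eq_one γ
  have hn : ‖B γ y e‖ = ‖y‖ := by rw [hB, he, mul_one]
  -- A phase `c` rotates the scalar `B γ y e` onto the nonnegative real axis.
  obtain ⟨c, hc, hc'⟩ := RCLike.exists_norm_eq_mul_self (B γ y e)
  refine ⟨c • e, by rw [norm_smul, hc, he, mul_one], ?_⟩
  rw [map_smul, smul_eq_mul, ← hc', hn]

theorem IsAdjointPair.norm_convOp_le {B : ∀ γ, L'.fiber γ →ₗ[𝕜] L.fiber γ →ₗ[𝕜] 𝕜}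
    (hB : ∀ γ a b, ‖B γ a b‖ = ‖a‖ * ‖b‖) {f : L.CcAlg} {f' : L'.CcAlg}
    (h : IsAdjointPair B f.val f'.val) {p q : ℝ≥0∞} [Fact (1 ≤ p)] [Fact (1 ≤ q)]
    (hpq : p⁻¹ + q⁻¹ = 1) (hqp : q⁻¹ + p⁻¹ = 1) :
    ‖convOp hqp f'‖ ≤ ‖convOp hpq f‖ := by
  classical
  refine ContinuousLinearMap.opNorm_le_bound _ (norm_nonneg _) fun ξ' => ?_
  -- It suffices to pair `f' * ξ'` with finitely supported `ξ`; there adjointness moves the operator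
  -- onto `ξ`, and Hölder's inequality bounds `⟨ξ', f * ξ⟩`.
  refine lp.norm_le_of_forall_pairing_le hpq B (exists_pairing_eq_norm hB) _ (by positivity)
    fun s e => ?_
  let Bc : ∀ γ, L'.fiber γ →L[𝕜] L.fiber γ →L[𝕜] 𝕜 := fun γ =>
    LinearMap.mkContinuous₂ (B γ) 1 fun a b => by rw [hB, one_mul]
  have hBc : ∀ γ, ‖Bc γ‖ ≤ (1 : NNReal) := fun γ =>
    LinearMap.mkContinuous₂_norm_le _ zero_le_one _
  have : q.HolderConjugate p := ⟨by rw [inv_one, hqp]⟩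
  let P := lp.dualPairing q p Bc hBc
  have hsum : ∑ β ∈ s, B β ((convOp hqp f' ξ' : ∀ γ, L'.fiber γ) β) (e β) =
      P ξ' (convOp hpq f (∑ β ∈ s, (lp.single p β (e β) : lp L.fiber p))) := by
    rw [map_sum, map_sum]
    refine Finset.sum_congr rfl fun β _ => ?_
    refine (h.hasSum f'.mem ξ' β (e β)).tsum_eq.symm.trans ?_
    rw [lp.dualPairing_apply]
    rfl
  rw [hsum]
  calc ‖P ξ' (convOp hpq f (∑ β ∈ s, (lp.single p β (e β) : lp L.fiber p)))‖
      ≤ 1 * ‖ξ'‖ * (‖convOp hpq f‖ * ‖∑ β ∈ s, (lp.single p β (e β) : lp L.fiber p)‖) :=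
        P.le_of_opNorm₂_le_of_le (lp.norm_dualPairing Bc hBc) le_rfl
          ((convOp hpq f).le_opNorm _)
    _ = _ := by ring

theorem IsAdjointPair.norm_convOp_eq {B : ∀ γ, L'.fiber γ →ₗ[𝕜] L.fiber γ →ₗ[𝕜] 𝕜}
    (hB : ∀ γ a b, ‖B γ a b‖ = ‖a‖ * ‖b‖) {f : L.CcAlg} {f' : L'.CcAlg}
    (h : IsAdjointPair B f.val f'.val) {p q : ℝ≥0∞} [Fact (1 ≤ p)] [Fact (1 ≤ q)]
    (hpq : p⁻¹ + q⁻¹ = 1) (hqp : q⁻¹ + p⁻¹ = 1) :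
    ‖convOp hqp f'‖ = ‖convOp hpq f‖ :=
  le_antisymm (h.norm_convOp_le hB hpq hqp)
    (IsAdjointPair.norm_convOp_le (B := fun γ => (B γ).flip)
      (fun γ a b => (hB γ b a).trans (mul_comm _ _)) h.flip hqp hpq)

end Adjoint

end Twist

namespace Arr

variable {X : Type u} [Groupoid.{v} X]

theorem isComp_inv_self (γ : Quiver.Total X) : IsComp (inv γ) γ (unit γ.left) :=
  isComp_iff.2 ⟨_, _, _, γ.hom, Groupoid.inv γ.hom, rfl, rfl, by simp [unit]⟩

end Arr

namespace Twist

variable {𝕜 : Type} [RCLike 𝕜] {X : Type u} [TopologicalSpace X] [Groupoid.{v} X]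
  [TopologicalSpace (Quiver.Total X)]

/-! ### Anti-isomorphisms of twists -/

/-- An isomorphism from the opposite of the twist `L` to `L'`. -/
structure AntiIso (L : Twist.{u, v, w} 𝕜 X) (L' : Twist.{u, v, w'} 𝕜 X) where
  toLin : ∀ γ, L.fiber (Arr.inv γ) ≃ₗ[𝕜] L'.fiber γ
  norm_map : ∀ γ z, ‖toLin γ z‖ = ‖z‖
  isInducing : IsInducing fun z : TotalSpace 𝕜 L'.fiber =>
    (⟨Arr.inv z.proj, (toLin z.proj).symm z.snd⟩ : TotalSpace 𝕜 L.fiber)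
  map_mul : ∀ {α β γ : Quiver.Total X} (h : Arr.IsComp α β γ) (a : L.fiber (Arr.inv α))
    (b : L.fiber (Arr.inv β)), L'.mul h (toLin α a) (toLin β b) = toLin γ (L.mul h.inv b a)

theorem _root_.IsBisection.preimage_inv [IsEtaleGroupoid X] {U : Set (Quiver.Total X)}
    (hU : IsBisection U) : IsBisection (Arr.inv ⁻¹' U) := by
  refine IsBisection.of_injOn (hU.isOpen.preimage IsEtaleGroupoid.continuous_inv) ?_ ?_
  · intro γ hγ γ' hγ' h
    exact Arr.inv_injective (hU.injOn_right hγ hγ' h)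
  · intro γ hγ γ' hγ' h
    exact Arr.inv_injective (hU.injOn_left hγ hγ' h)

namespace AntiIso

variable {L : Twist.{u, v, w} 𝕜 X} {L' : Twist.{u, v, w'} 𝕜 X} (T : AntiIso L L')

/-- The map `f ↦ f̌`, `f̌(γ) = f(γ⁻¹)`, on sections. -/
def check (f : L.Section) : L'.Section := fun γ => T.toLin γ (f (Arr.inv γ))

/-- Inverting `γ⁻¹ = ηβ` gives `γ = β⁻¹η⁻¹`, so `η ↦ β⁻¹` is a bijection between the index sets of
the two convolution sums, and `T.map_mul` swaps the factors. -/
theorem conv_check {f : L.Section} (hf : f ∈ L.Cc) (g : L.Section) :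
    L'.conv (T.check g) (T.check f) = T.check (L.conv f g) := by
  funext γ
  have hfin := finite_conv_support hf g (Arr.inv γ)
  have hmap : T.check (L.conv f g) γ = ∑ᶠ η : {η : Quiver.Total X // η.right = γ.left},
      T.toLin γ (L.mul (Arr.isComp_ldiv η.1 (Arr.inv γ) η.2) (f η.1)
        (g (Arr.ldiv η.1 (Arr.inv γ) η.2))) :=
    AddMonoidHom.map_finsum (T.toLin γ).toLinearMap.toAddMonoidHom hfin
  rw [hmap]
  let φ : {η : Quiver.Total X // η.right = γ.left} → {η : Quiver.Total X // η.right = γ.right} :=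
    fun η => ⟨Arr.inv (Arr.ldiv η.1 (Arr.inv γ) η.2),
      (Arr.isComp_ldiv η.1 (Arr.inv γ) η.2).left_eq.symm⟩
  have key : ∀ η, Arr.IsComp (φ η).1 (Arr.inv η.1) γ := by
    intro η
    have := (Arr.isComp_ldiv η.1 (Arr.inv γ) η.2).inv
    rwa [Arr.inv_inv] at this
  have hφ : Function.Bijective φ := by
    constructor
    · intro η η' he
      have h1 := key η
      rw [he] at h1
      exact Subtype.ext (Arr.inv_injective (h1.unique_right (key η')))
    · rintro ⟨η, hη⟩
      have hc := Arr.isComp_ldiv η γ hη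
      refine ⟨⟨Arr.inv (Arr.ldiv η γ hη), hc.left_eq.symm⟩, Subtype.ext ?_⟩
      have h1 := key ⟨Arr.inv (Arr.ldiv η γ hη), hc.left_eq.symm⟩
      rw [Arr.inv_inv] at h1
      exact h1.unique_left hc
  unfold conv
  refine (finsum_eq_of_bijective φ hφ fun η => ?_).symm
  unfold check
  rw [T.map_mul]
  congr 1
  have h1 : Arr.ldiv (φ η).1 γ (φ η).2 = Arr.inv η.1 :=
    (Arr.isComp_ldiv _ _ _).unique_right (key η)
  -- The factors lie over `η` and `(η⁻¹)⁻¹`; comparing them in the total space avoids transport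
  -- between the fibers.
  refine L.mul_congr ?_ ?_ _ _
  · rw [h1, Arr.inv_inv]
  · change _ = (⟨Arr.inv (Arr.inv _), g (Arr.inv (Arr.inv _))⟩ : TotalSpace 𝕜 L.fiber)
    rw [Arr.inv_inv]

theorem check_add (f g : L.Section) : T.check (f + g) = T.check f + T.check g :=
  funext fun γ => map_add (T.toLin γ) _ _

theorem check_smul (c : 𝕜) (f : L.Section) : T.check (c • f) = c • T.check f :=
  funext fun γ => map_smul (T.toLin γ) _ _

theorem check_injective : Function.Injective T.check := by
  intro f g h
  funext γ
  have h1 := (T.toLin (Arr.inv γ)).injective (congrFun h (Arr.inv γ))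
  rwa [Arr.inv_inv] at h1

theorem exists_check_eq (g : L'.Section) : ∃ f, T.check f = g := by
  -- Stating the condition for every `γ'` with `γ = γ'⁻¹` lets the chosen section be evaluated at
  -- `γ'⁻¹` with `h = rfl`.
  have : ∀ γ, ∃ z : L.fiber γ, ∀ γ' (h : γ = Arr.inv γ'), T.toLin γ' (h ▸ z) = g γ' := by
    intro γ
    obtain ⟨δ, rfl⟩ : ∃ δ, γ = Arr.inv δ := ⟨Arr.inv γ, (Arr.inv_inv γ).symm⟩
    refine ⟨(T.toLin δ).symm (g δ), fun γ' h => ?_⟩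
    obtain rfl := Arr.inv_injective h
    exact (T.toLin δ).apply_symm_apply _
  choose f hf using this
  exact ⟨f, funext fun γ => hf _ γ rfl⟩

/-! ### The map `f ↦ f̌` on quasi-continuous sections -/

section Etale

variable [IsEtaleGroupoid X]

theorem isCcOn_check {U : Set (Quiver.Total X)} {f : L.Section} (hf : L.IsCcOn U f) :
    L'.IsCcOn (Arr.inv ⁻¹' U) (T.check f) := by
  constructor
  · rw [T.isInducing.continuousOn_iff]
    refine (hf.continuousOn.comp IsEtaleGroupoid.continuous_inv.continuousOn
      fun _ h => h).congr fun γ _ => ?_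
    simp [check]
  · obtain ⟨K, hKU, hK, h0⟩ := hf.compact
    refine ⟨Arr.inv '' K, ?_, hK.image IsEtaleGroupoid.continuous_inv, fun γ hγ => ?_⟩
    · rintro _ ⟨γ, hγ, rfl⟩
      rw [Set.mem_preimage, Arr.inv_inv]
      exact hKU hγ
    · rw [check, h0 _ fun h => hγ ⟨_, h, Arr.inv_inv γ⟩, map_zero]

/-- The converse of `isCcOn_check`, needed for `f ↦ f̌` to map onto `L'.Cc`. -/
theorem isCcOn_of_check {U : Set (Quiver.Total X)} {f : L.Section}
    (hf : L'.IsCcOn U (T.check f)) : L.IsCcOn (Arr.inv ⁻¹' U) f := by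
  constructor
  · refine ((T.isInducing.continuousOn_iff.1 hf.continuousOn).comp
      IsEtaleGroupoid.continuous_inv.continuousOn fun _ h => h).congr fun γ _ => ?_
    change _ = (⟨Arr.inv (Arr.inv γ), (T.toLin (Arr.inv γ)).symm (T.toLin (Arr.inv γ)
      (f (Arr.inv (Arr.inv γ))))⟩ : TotalSpace 𝕜 L.fiber)
    rw [LinearEquiv.symm_apply_apply, Arr.inv_inv]
  · obtain ⟨K, hKU, hK, h0⟩ := hf.compact
    refine ⟨Arr.inv '' K, ?_, hK.image IsEtaleGroupoid.continuous_inv, fun γ hγ => ?_⟩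
    · rintro _ ⟨γ, hγ, rfl⟩
      rw [Set.mem_preimage, Arr.inv_inv]
      exact hKU hγ
    · have h1 := h0 (Arr.inv γ) fun h => hγ ⟨_, h, Arr.inv_inv γ⟩
      have h2 := (LinearEquiv.map_eq_zero_iff _).1 h1
      rwa [Arr.inv_inv] at h2

theorem check_mem {f : L.Section} (hf : f ∈ L.Cc) : T.check f ∈ L'.Cc := by
  induction hf using Submodule.span_induction with
  | zero =>
    convert zero_mem L'.Cc
    exact funext fun γ => map_zero (T.toLin γ)
  | add f g _ _ hf hg => rw [check_add]; exact add_mem hf hg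
  | smul c f _ hf => rw [check_smul]; exact Submodule.smul_mem _ c hf
  | mem f hf =>
    obtain ⟨U, hU, hfU⟩ := hf
    exact Submodule.subset_span ⟨_, hU.preimage_inv, T.isCcOn_check hfU⟩

theorem exists_mem_check_eq {g : L'.Section} (hg : g ∈ L'.Cc) : ∃ f ∈ L.Cc, T.check f = g := by
  induction hg using Submodule.span_induction with
  | zero => exact ⟨0, zero_mem _, funext fun γ => map_zero (T.toLin γ)⟩
  | add _ _ _ _ hf hg =>
    obtain ⟨f, hf, rfl⟩ := hf
    obtain ⟨g, hg, rfl⟩ := hg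
    exact ⟨f + g, add_mem hf hg, T.check_add f g⟩
  | smul c _ _ hf =>
    obtain ⟨f, hf, rfl⟩ := hf
    exact ⟨c • f, Submodule.smul_mem _ c hf, T.check_smul c f⟩
  | mem g hg =>
    obtain ⟨U, hU, hgU⟩ := hg
    obtain ⟨f, rfl⟩ := T.exists_check_eq g
    exact ⟨f, Submodule.subset_span ⟨_, hU.preimage_inv, T.isCcOn_of_check hgU⟩, rfl⟩

/-- The map `f ↦ f̌` as a linear map of convolution algebras. -/
def checkₗ : L.CcAlg →ₗ[𝕜] L'.CcAlg where
  toFun f := CcAlg.mk (T.check f.val) (T.check_mem f.mem)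
  map_add' (f g : L.CcAlg) := CcAlg.ext (T.check_add f.val g.val)
  map_smul' c (f : L.CcAlg) := CcAlg.ext (T.check_smul c f.val)

/-- The map `f ↦ f̌` as a linear equivalence of convolution algebras. -/
noncomputable def checkEquiv : L.CcAlg ≃ₗ[𝕜] L'.CcAlg :=
  LinearEquiv.ofBijective T.checkₗ
    ⟨fun f g h => CcAlg.ext (T.check_injective (congrArg CcAlg.val h)), fun g => by
      obtain ⟨f, hf, h⟩ := T.exists_mem_check_eq g.mem
      exact ⟨CcAlg.mk f hf, CcAlg.ext h⟩⟩

theorem checkEquiv_mul [T2Space X] (f g : L.CcAlg) :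
    T.checkEquiv (f * g) = T.checkEquiv g * T.checkEquiv f :=
  CcAlg.ext (T.conv_check f.mem g.val).symm

end Etale

/-! ### The pairing of a twist with its opposite -/

/-- A norming functional for a unit vector that spans the fiber is isometric on it. The functionals
are chosen fiber by fiber; no continuity is needed, since `ℓ^p` ignores the topology of `G`. -/
theorem _root_.Twist.exists_norm_preserving (L : Twist.{u, v, w} 𝕜 X) (γ : Quiver.Total X) :
    ∃ φ : L.fiber γ →ₗ[𝕜] 𝕜, ∀ z, ‖φ z‖ = ‖z‖ := by
  obtain ⟨e, he⟩ := L.exists_norm_eq_one γ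
  have he0 : e ≠ 0 := fun h => by simp [h] at he
  have hspan := (finrank_eq_one_iff_of_nonzero' e he0).1 (L.finrank_fiber γ)
  obtain ⟨φ, hφ⟩ := exists_dual_vector 𝕜 e (norm_ne_zero_iff.2 he0)
  refine ⟨φ, fun z => ?_⟩
  obtain ⟨c, rfl⟩ := hspan z
  rw [map_smul, norm_smul, norm_smul, he]
  simp [hφ.2, he]

/-- With `B γ a b = φ(a · b)`, `a` being viewed in `L_{γ⁻¹}`, both sides of the adjointness relation
are `φ(a · f(α) · b)`, bracketed in two ways. -/
theorem exists_isAdjointPair : ∃ B : ∀ γ, L'.fiber γ →ₗ[𝕜] L.fiber γ →ₗ[𝕜] 𝕜,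
    (∀ γ a b, ‖B γ a b‖ = ‖a‖ * ‖b‖) ∧ ∀ f, IsAdjointPair B f (T.check f) := by
  choose φ hφ using L.exists_norm_preserving
  refine ⟨fun γ => ((L.mul (Arr.isComp_inv_self γ)).compr₂ (φ _)).comp
    (T.toLin γ).symm.toLinearMap, fun γ a b => ?_, fun f => ?_⟩
  · obtain ⟨a, rfl⟩ := (T.toLin γ).surjective a
    simp [hφ, L.norm_mul, T.norm_map]
  · intro α α' β γ h h' a b
    obtain ⟨a, rfl⟩ := (T.toLin γ).surjective a
    -- Now `γ` and `β` visibly share the domain `x`, so both sides use the same functional `φ`;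
    -- next, `α'` is forced to be `α⁻¹`.
    obtain ⟨x, y, z, g, k, rfl, rfl, rfl⟩ := Arr.isComp_iff.1 h
    obtain rfl := h'.unique_left (Arr.isComp_inv_left h)
    change φ _ (L.mul _ ((T.toLin _).symm (T.toLin _ a)) (L.mul h (f _) b)) =
      φ _ (L.mul _ ((T.toLin _).symm (L'.mul h' (T.toLin _ (f _)) (T.toLin _ a))) b)
    rw [T.map_mul, LinearEquiv.symm_apply_apply, LinearEquiv.symm_apply_apply]
    congr 1
    have h₁ := h'.inv
    rw [Arr.inv_inv] at h₁
    refine (L.mul_assoc h₁ (Arr.isComp_inv_self _) h (Arr.isComp_inv_self _) a _ b).symm.trans ?_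
    refine L.mul_congr ?_ rfl _ _
    exact congrArg _ (L.mul_congr rfl (by rw [Arr.inv_inv]) _ _)

end AntiIso

end Twist

/-! ### Duality of the reduced algebras -/

/-- An isometric anti-isomorphism between dense subalgebras extends to the completions. -/
theorem exists_opposite_linearIsometryEquiv {𝕜 A A' R R' : Type*} [NontriviallyNormedField 𝕜]
    [NonUnitalNonAssocRing A] [Module 𝕜 A] [NonUnitalNonAssocRing A'] [Module 𝕜 A']
    [NonUnitalNormedRing R] [Module 𝕜 R] [CompleteSpace R]
    [NonUnitalNormedRing R'] [Module 𝕜 R'] [CompleteSpace R']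
    (hR : ∀ (t : 𝕜) (a : R), ‖t • a‖ ≤ ‖t‖ * ‖a‖)
    (hR' : ∀ (t : 𝕜) (a : R'), ‖t • a‖ ≤ ‖t‖ * ‖a‖) (c : A ≃ₗ[𝕜] A')
    (hc : ∀ f g, c (f * g) = c g * c f) (e : A →ₗ[𝕜] R) (e' : A' →ₗ[𝕜] R')
    (he : ∀ f g, e (f * g) = e f * e g) (he' : ∀ f g, e' (f * g) = e' f * e' g)
    (hd : DenseRange e) (hd' : DenseRange e') (hn : ∀ f, ‖e' (c f)‖ = ‖e f‖) :
    ∃ Φ : Rᵐᵒᵖ ≃ₗᵢ[𝕜] R', (∀ a b, Φ (a * b) = Φ a * Φ b) ∧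
      ∀ f, Φ (MulOpposite.op (e f)) = e' (c f) := by
  -- The bounds `hR` and `hR'` turn the given module structures themselves into normed spaces.
  let _ : NormedSpace 𝕜 R := { norm_smul_le := hR }
  let _ : NormedSpace 𝕜 R' := { norm_smul_le := hR' }
  let e₁ : A →ₗ[𝕜] Rᵐᵒᵖ := (MulOpposite.opLinearEquiv 𝕜).toLinearMap ∘ₗ e
  have h₁ : DenseRange e₁ :=
    MulOpposite.op_surjective.denseRange.comp hd MulOpposite.continuous_op
  let Φ := c.extendOfIsometry e₁ e' h₁ hd' hn
  have hΦ : ∀ f, Φ (e₁ f) = e' (c f) := c.extendOfIsometry_eq e₁ e' h₁ hd' hn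
  refine ⟨Φ, fun a b => ?_, hΦ⟩
  have hcont : Continuous Φ := Φ.continuous
  refine h₁.induction_on₂ (p := fun a b => Φ (a * b) = Φ a * Φ b)
    (isClosed_eq (by fun_prop) (by fun_prop)) (fun f g => ?_) a b
  -- Two reversals cancel: one from the opposite algebra, one from `c`.
  have hm : e₁ f * e₁ g = e₁ (g * f) := congrArg MulOpposite.op (he g f).symm
  rw [hm, hΦ, hΦ, hΦ, hc, he']

namespace Twist

variable {𝕜 : Type} [RCLike 𝕜] {X : Type u} [TopologicalSpace X] [Groupoid.{v} X]
  [TopologicalSpace (Quiver.Total X)] [IsEtaleGroupoid X]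

/-- The identity map as an isomorphism from the opposite of `L` to `L.op`. -/
def opAntiIso (L : Twist.{u, v, w} 𝕜 X) : AntiIso L L.op where
  toLin γ := LinearEquiv.refl 𝕜 (L.fiber (Arr.inv γ))
  norm_map _ _ := rfl
  isInducing := ⟨rfl⟩
  map_mul _ _ _ := rfl

/-- The trivial twist is isomorphic to its opposite. -/
def trivialAntiIso (𝕜 : Type) [RCLike 𝕜] (X : Type u) [TopologicalSpace X] [Groupoid.{v} X]
    [TopologicalSpace (Quiver.Total X)] [IsEtaleGroupoid X] :
    AntiIso (trivial 𝕜 X) (trivial 𝕜 X) where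
  toLin _ := LinearEquiv.refl 𝕜 𝕜
  norm_map _ _ := rfl
  isInducing := by
    have h := trivial_inducing 𝕜 X
    have hinv : IsInducing (Arr.inv : Quiver.Total X → Quiver.Total X) :=
      (Homeomorph.mk ⟨Arr.inv, Arr.inv, Arr.inv_inv, Arr.inv_inv⟩
        IsEtaleGroupoid.continuous_inv IsEtaleGroupoid.continuous_inv).isInducing
    -- In the coordinates `G × 𝕜` the map is inversion times the identity.
    exact h.of_comp_iff.1 ((hinv.prodMap IsInducing.id).comp h)
  map_mul _ a b := mul_comm (G := 𝕜) a b

theorem normD_check (L : Twist.{u, v, w} 𝕜 X) (f : L.Section) :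
    L.op.normD (L.check f) = L.normR f := by
  refine iSup_congr fun x => ?_
  let e : {γ : Quiver.Total X // γ.left = x} ≃ {γ : Quiver.Total X // γ.right = x} :=
    ⟨fun γ => ⟨Arr.inv γ.1, γ.2⟩, fun γ => ⟨Arr.inv γ.1, γ.2⟩,
      fun γ => Subtype.ext (Arr.inv_inv _), fun γ => Subtype.ext (Arr.inv_inv _)⟩
  exact e.tsum_eq fun γ : {γ : Quiver.Total X // γ.right = x} => ‖f γ.1‖ₑ

variable [T2Space X]

/-! ### The closed image as a Banach algebra -/

section ClosedImage

variable {L : Twist.{u, v, w} 𝕜 X} {E : Type*} [NormedAddCommGroup E] [NormedSpace 𝕜 E]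
  (Λ : L.BanachAlg →ₙₐ[𝕜] (E →L[𝕜] E))

/-- The map `f ↦ Λ(f)` as a linear map into `closedImage Λ`. -/
noncomputable def toClosedImageₗ : L.CcAlg →ₗ[𝕜] closedImage Λ where
  toFun := toClosedImage Λ
  map_add' f g := Subtype.ext (map_add (Λ.comp L.toBanachAlg) f g)
  map_smul' c f := Subtype.ext (map_smul (Λ.comp L.toBanachAlg) c f)

theorem toClosedImage_mul (f g : L.CcAlg) :
    toClosedImage Λ (f * g) = toClosedImage Λ f * toClosedImage Λ g :=
  Subtype.ext (map_mul (Λ.comp L.toBanachAlg) f g)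

theorem denseRange_toClosedImage : DenseRange (toClosedImage Λ) := by
  rintro ⟨a, ha⟩
  rw [closure_subtype, ← Set.range_comp]
  exact ha

instance completeSpace_closedImage [CompleteSpace E] : CompleteSpace (closedImage Λ) :=
  (NonUnitalSubalgebra.isClosed_topologicalClosure _).completeSpace_coe

theorem norm_smul_closedImage_le (c : 𝕜) (a : closedImage Λ) : ‖c • a‖ ≤ ‖c‖ * ‖a‖ :=
  norm_smul_le c a.1

end ClosedImage

namespace AntiIso

variable {L : Twist.{u, v, w} 𝕜 X} {L' : Twist.{u, v, w'} 𝕜 X} (T : AntiIso L L')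
  {p q : ℝ≥0∞} [Fact (1 ≤ p)] [Fact (1 ≤ q)]
  {Λ : L.BanachAlg →ₙₐ[𝕜] (L.ellP p →L[𝕜] L.ellP p)}
  {Λ' : L'.BanachAlg →ₙₐ[𝕜] (L'.ellP q →L[𝕜] L'.ellP q)}

/-- Convolution by `f̌` on `ℓ^q` and by `f` on `ℓ^p` are adjoint under the fiberwise pairing. -/
theorem norm_regularRep_check (hpq : p⁻¹ + q⁻¹ = 1) (hΛ : IsRegularRep Λ)
    (hΛ' : IsRegularRep Λ') (f : L.CcAlg) :
    ‖Λ' (L'.toBanachAlg (T.checkEquiv f))‖ = ‖Λ (L.toBanachAlg f)‖ := by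
  have hqp : q⁻¹ + p⁻¹ = 1 := by rw [add_comm, hpq]
  obtain ⟨B, hB, h⟩ := T.exists_isAdjointPair
  rw [hΛ.eq_convOp hpq, hΛ'.eq_convOp hqp]
  exact IsAdjointPair.norm_convOp_eq hB (f := f) (f' := T.checkEquiv f) (h f.val) hpq hqp

/-- The map `f ↦ f̌` extends to an isometric isomorphism from the opposite of `F^p_red(G, L)` to
`F^q_red(G, L')`. -/
theorem exists_linearIsometryEquiv (hpq : p⁻¹ + q⁻¹ = 1) (hΛ : IsRegularRep Λ)
    (hΛ' : IsRegularRep Λ') : ∃ Φ : (closedImage Λ)ᵐᵒᵖ ≃ₗᵢ[𝕜] closedImage Λ',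
      (∀ a b, Φ (a * b) = Φ a * Φ b) ∧
      ∀ f : L.CcAlg, Φ (MulOpposite.op (toClosedImage Λ f)) =
        toClosedImage Λ' (T.checkEquiv f) := by
  have hn : ∀ f, ‖toClosedImageₗ Λ' (T.checkEquiv f)‖ = ‖toClosedImageₗ Λ f‖ :=
    T.norm_regularRep_check hpq hΛ hΛ'
  exact exists_opposite_linearIsometryEquiv (norm_smul_closedImage_le Λ)
    (norm_smul_closedImage_le Λ') T.checkEquiv T.checkEquiv_mul
    (toClosedImageₗ Λ) (toClosedImageₗ Λ') (toClosedImage_mul Λ) (toClosedImage_mul Λ')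
    (denseRange_toClosedImage Λ) (denseRange_toClosedImage Λ') hn

end AntiIso

/-- By duality this is the `ℓ^1` norm of `f̌` over the opposite twist, and inversion exchanges the
fibers of `d` and `r`. -/
theorem IsRegularRep.enorm_eq_normR {L : Twist.{u, v, w} 𝕜 X} [Fact (1 ≤ (∞ : ℝ≥0∞))]
    {Λ : L.BanachAlg →ₙₐ[𝕜] (L.ellP ∞ →L[𝕜] L.ellP ∞)}
    (hΛ : IsRegularRep Λ) (f : L.CcAlg) : ‖Λ (L.toBanachAlg f)‖ₑ = L.normR f.val := by
  have hΛ' := L.op.isRegularRep_regularRep (p := 1) (q := ∞) (by simp)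
  have h := L.opAntiIso.norm_regularRep_check (by simp) hΛ hΛ' f
  rw [← ofReal_norm, ← h, ofReal_norm, hΛ'.enorm_eq_normD]
  exact L.normD_check f.val

end Twist

theorem mainTheorem12 {𝕜 : Type} [RCLike 𝕜] {X : Type u} [TopologicalSpace X] [T2Space X]
    [LocallyCompactSpace X] [Groupoid.{v} X] [TopologicalSpace (Quiver.Total X)]
    [IsEtaleGroupoid X] (L : Twist.{u, v, w} 𝕜 X)
    (p q : ℝ≥0∞) [Fact (1 ≤ p)] [Fact (1 ≤ q)] (hpq : p⁻¹ + q⁻¹ = 1) :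
    (∃! Λ : L.BanachAlg →ₙₐ[𝕜] (L.ellP p →L[𝕜] L.ellP p), Twist.IsRegularRep Λ) ∧
    (∀ Λ : L.BanachAlg →ₙₐ[𝕜] (L.ellP p →L[𝕜] L.ellP p), Twist.IsRegularRep Λ →
      Function.Injective (fun f : L.CcAlg => Λ (L.toBanachAlg f)) ∧
      (∀ f : L.CcAlg,
        ‖Λ (L.toBanachAlg f)‖ₑ ≤ L.normD f.val ^ p⁻¹.toReal * L.normR f.val ^ q⁻¹.toReal ∧
        L.normD f.val ^ p⁻¹.toReal * L.normR f.val ^ q⁻¹.toReal ≤ L.normI f.val) ∧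
      (p = 1 → ∀ f : L.CcAlg, ‖Λ (L.toBanachAlg f)‖ₑ = L.normD f.val) ∧
      (p = ∞ → ∀ f : L.CcAlg, ‖Λ (L.toBanachAlg f)‖ₑ = L.normR f.val) ∧
      (∀ Λ' : L.op.BanachAlg →ₙₐ[𝕜] (L.op.ellP q →L[𝕜] L.op.ellP q), Twist.IsRegularRep Λ' →
        ∃ Φ : (Twist.closedImage Λ)ᵐᵒᵖ ≃ₗᵢ[𝕜] Twist.closedImage Λ',
          (∀ a b, Φ (a * b) = Φ a * Φ b) ∧
          ∀ f : L.CcAlg, Φ (MulOpposite.op (Twist.toClosedImage Λ f)) = Twist.toClosedImage Λ' f.check)) ∧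
    (∀ (Λ : (Twist.trivial 𝕜 X).BanachAlg →ₙₐ[𝕜]
          ((Twist.trivial 𝕜 X).ellP p →L[𝕜] (Twist.trivial 𝕜 X).ellP p))
        (Λ' : (Twist.trivial 𝕜 X).BanachAlg →ₙₐ[𝕜]
          ((Twist.trivial 𝕜 X).ellP q →L[𝕜] (Twist.trivial 𝕜 X).ellP q)),
      Twist.IsRegularRep Λ → Twist.IsRegularRep Λ' →
        ∃ Φ : (Twist.closedImage Λ)ᵐᵒᵖ ≃ₗᵢ[𝕜] Twist.closedImage Λ',
          (∀ a b, Φ (a * b) = Φ a * Φ b) ∧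
          ∀ f : (Twist.trivial 𝕜 X).CcAlg, ∃ g : (Twist.trivial 𝕜 X).CcAlg,
            (∀ γ, g.val γ = f.val (Arr.inv γ)) ∧
            Φ (MulOpposite.op (Twist.toClosedImage Λ f)) = Twist.toClosedImage Λ' g) := by
  refine ⟨⟨L.regularRep hpq, L.isRegularRep_regularRep hpq, fun Λ hΛ =>
    hΛ.unique (L.isRegularRep_regularRep hpq)⟩, fun Λ hΛ => ⟨hΛ.injective, fun f =>
    ⟨hΛ.enorm_le hpq f, Twist.schurBound_le_normI hpq f.val⟩, ?_, ?_, fun Λ' hΛ' =>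
    -- All maps `toLin` of `opAntiIso` are identities, so `checkEquiv f` is `f.check` by definition.
    L.opAntiIso.exists_linearIsometryEquiv hpq hΛ hΛ'⟩, fun Λ Λ' hΛ hΛ' => ?_⟩
  · rintro rfl
    exact hΛ.enorm_eq_normD
  · rintro rfl
    exact hΛ.enorm_eq_normR
  · obtain ⟨Φ, hmul, hΦ⟩ :=
      (Twist.trivialAntiIso 𝕜 X).exists_linearIsometryEquiv hpq hΛ hΛ'
    exact ⟨Φ, hmul, fun f => ⟨(Twist.trivialAntiIso 𝕜 X).checkEquiv f, fun _ => rfl, hΦ f⟩⟩
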